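/- **Conventions.** Everything is real and finite dimensional; Lie groups are smooth and not necessarily connected. The Lie bracket on the Lie algebra $T_eG$ of a Lie group $G$ is the bracket of right invariant vector fields. For $V\in\wedge^k T_eG$, $V^{\mathsf l}$ and $V^{\mathsf r}$ denote the left and right invariant $k$-vector fields with value $V$ at $e$; likewise $\xi^{\mathsf l}$, $\xi^{\mathsf r}$ for covectors. We write $\mathsf l_g,\mathsf r_g$ for left and right translation (and their differentials), and $a\wedge b=a\otimes b-b\otimes a$. A *Poisson Lie group* is a Lie group $G$ with a Poisson bivector field $\pi$ such that $\pi|_{gh}=\mathsf l_g(\pi|_h)+\mathsf r_h(\pi|_g)$ for all $g,h\in G$; its Lie bialgebra is $(\mathfrak g,\delta_*)$, where $\mathfrak g=T_eG$ and $\delta_*(u)\in\wedge^2\mathfrak g$ is the derivative at $e$ in the direction $u$ of $g\mapsto \mathsf r_{g^{-1}}(\pi|_g)$. A *Poisson Lie group homomorphism* is a Lie group homomorphism between Poisson Lie groups that is a Poisson map. Let $(\mathfrak g,\delta_*)$ be a Lie bialgebra, i.e. $\mathfrak g$ is a Lie algebra and $\delta_*:\mathfrak g\to\wedge^2\mathfrak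 g$ is a $1$-cocycle such that $[\xi,\eta]_{\mathfrak g^*}(u)=-\delta_*(u)(\xi,\eta)$ is a Lie bracket on $\mathfrak g^*$. Let $\mathfrak d=\mathfrak g\oplus\mathfrak g^*$ be its Drinfeld double Lie algebra, with the bracket $$[u+\xi,w+\eta]=[u,w]_{\mathfrak g}+\mathrm{ad}^*_\xi w-\mathrm{ad}^*_\eta u+[\xi,\eta]_{\mathfrak g^*}+\mathrm{ad}^*_u\eta-\mathrm{ad}^*_w\xi,$$ where $(\mathrm{ad}^*_u\xi)(w)=\xi([w,u]_{\mathfrak g})$ and $\eta(\mathrm{ad}^*_\xi u)=[\eta,\xi]_{\mathfrak g^*}(u)$, and with the invariant bilinear form $\langle u+\xi,w+\eta\rangle=\eta(u)+\xi(w)$. Let $\mathrm{pr}_{\mathfrak g},\mathrm{pr}_{\mathfrak g^*}$ be the projections of $\mathfrak d$ onto $\mathfrak g$ and $\mathfrak g^*$. Let $D$ be a Lie group with Lie algebra $\mathfrak d$ whose adjoint action on $\mathfrak d$ preserves $\langle\,,\rangle$, and put $$\pi_D=R^{\mathsf r}-R^{\mathsf l},\qquad R=\tfrac12\sum_i\xi_i\wedge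 u_i\in\wedge^2\mathfrak d,$$ where $(u_i)$ is any basis of $\mathfrak g$ and $(\xi_i)$ is the dual basis of $\mathfrak g^*$. Let $G$ and $G^*$ be Lie groups with Lie algebras $\mathfrak g$ and $\mathfrak g^*$, and let $\phi_G:G\to D$, $g\mapsto\bar g$, and $\phi_{G^*}:G^*\to D$, $v\mapsto\bar v$, be Lie group homomorphisms whose differentials at the identity are the inclusions $\mathfrak g\to\mathfrak d$ and $\mathfrak g^*\to\mathfrak d$. Define $\pi_G$ on $G$ and $\pi_{G^*}$ on $G^*$ by $$\pi_G|_g(\xi_1^{\mathsf l},\xi_2^{\mathsf l})=\langle\mathrm{pr}_{\mathfrak g}(\mathrm{Ad}_{\bar g}\xi_1),\mathrm{pr}_{\mathfrak g^*}(\mathrm{Ad}_{\bar g}\xi_2)\rangle,\qquad g\in G,\ \xi_1,\xi_2\in\mathfrak g^*,$$ $$\pi_{G^*}|_v(u_1^{\mathsf r},u_2^{\mathsf r})=\langle\mathrm{pr}_{\mathfrak g}(\mathrm{Ad}_{\bar v^{-1}}u_1),\mathrm{pr}_{\mathfrak g^*}(\mathrm{Ad}_{\bar v^{-1}}u_2)\rangle,\qquad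 v\in G^*,\ u_1,u_2\in\mathfrak g.$$ **Lemma.** Both $(G,\pi_G)$ and $(G^*,\pi_{G^*})$ are Poisson Lie groups, and $$\phi_G:(G,\pi_G)\to(D,\pi_D)\qquad\text{and}\qquad\phi_{G^*}:(G^*,\pi_{G^*})\to(D,-\pi_D)$$ are Poisson Lie group homomorphisms. Moreover, the Lie bialgebra of $(G,\pi_G)$ is $(\mathfrak g,\delta_*)$, and $(G^*,\pi_{G^*})$ is a dual Poisson Lie group of $(G,\pi_G)$, i.e. its Lie bialgebra is $(\mathfrak g^*,\delta)$ with $\delta(\xi)(u_1,u_2)=-\xi([u_1,u_2]_{\mathfrak g})$. -/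

import Mathlib

open scoped Manifold ContDiff

set_option linter.unusedSectionVars false

noncomputable section

/-! ### Lie bialgebras and their doubles -/

/-- The bracket `[ξ, η](u) = - δ(u)(ξ, η)` on `𝔤*` determined by a linear map `δ : 𝔤 → ⋀² 𝔤`,
where `δ u ξ η` is the value of the bivector `δ(u)` on the pair of covectors `ξ, η`. -/
def cobracketDual {𝔤 : Type*} [AddCommGroup 𝔤] [Module ℝ 𝔤]
    (δ : 𝔤 →ₗ[ℝ] LinearMap.BilinForm ℝ (Module.Dual ℝ 𝔤)) (ξ η : Module.Dual ℝ 𝔤) :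
    Module.Dual ℝ 𝔤 :=
  -(LinearMap.applyₗ η ∘ₗ LinearMap.applyₗ ξ ∘ₗ δ)

/-- A (real) Lie bialgebra structure on a Lie algebra `𝔤`. The cobracket `δ_* : 𝔤 → ⋀² 𝔤` is
recorded through the values `δ_*(u)(ξ, η)` of the bivector `δ_*(u)` on pairs of covectors. -/
structure LieBialgebra (𝔤 : Type*) [LieRing 𝔤] [LieAlgebra ℝ 𝔤] where
  /-- `cobracket u ξ η = δ_*(u)(ξ, η)` -/
  cobracket : 𝔤 →ₗ[ℝ] LinearMap.BilinForm ℝ (Module.Dual ℝ 𝔤)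
  alt : ∀ u ξ, cobracket u ξ ξ = 0
  /-- The Jacobi identity for the bracket on `𝔤*` determined by `δ_*`. -/
  jacobi : ∀ ξ η ζ : Module.Dual ℝ 𝔤,
    cobracketDual cobracket (cobracketDual cobracket ξ η) ζ +
      cobracketDual cobracket (cobracketDual cobracket η ζ) ξ +
      cobracketDual cobracket (cobracketDual cobracket ζ ξ) η = 0
  /-- `δ_*([u, w]) = ad_u δ_*(w) - ad_w δ_*(u)`. -/
  cocycle : ∀ (u w : 𝔤) (ξ η : Module.Dual ℝ 𝔤),
    cobracket ⁅u, w⁆ ξ η =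
      (cobracket w (ξ ∘ₗ (LieAlgebra.ad ℝ 𝔤 u : 𝔤 →ₗ[ℝ] 𝔤)) η +
        cobracket w ξ (η ∘ₗ (LieAlgebra.ad ℝ 𝔤 u : 𝔤 →ₗ[ℝ] 𝔤))) -
      (cobracket u (ξ ∘ₗ (LieAlgebra.ad ℝ 𝔤 w : 𝔤 →ₗ[ℝ] 𝔤)) η +
        cobracket u ξ (η ∘ₗ (LieAlgebra.ad ℝ 𝔤 w : 𝔤 →ₗ[ℝ] 𝔤)))

namespace LieBialgebra

variable {𝔤 : Type*} [LieRing 𝔤] [LieAlgebra ℝ 𝔤] (B : LieBialgebra 𝔤)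

theorem cobracket_swap (u : 𝔤) (ξ η : Module.Dual ℝ 𝔤) :
    B.cobracket u ξ η = - B.cobracket u η ξ := by
  have h := B.alt u (ξ + η)
  simp only [map_add, LinearMap.add_apply, B.alt] at h
  linarith

/-- The dual Lie algebra `𝔤*` of a Lie bialgebra, as a copy of the dual vector space. -/
def DualAlg (_ : LieBialgebra 𝔤) : Type _ := Module.Dual ℝ 𝔤

instance : AddCommGroup B.DualAlg := inferInstanceAs (AddCommGroup (Module.Dual ℝ 𝔤))
instance : Module ℝ B.DualAlg := inferInstanceAs (Module ℝ (Module.Dual ℝ 𝔤))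

/-- `B.DualAlg` is `𝔤*` as a vector space. -/
def toDual : B.DualAlg ≃ₗ[ℝ] Module.Dual ℝ 𝔤 := LinearEquiv.refl ℝ _

/-- The bracket of `𝔤*`, given by `[ξ, η](u) = - δ_*(u)(ξ, η)`. -/
instance : Bracket B.DualAlg B.DualAlg where
  bracket ξ η := B.toDual.symm (cobracketDual B.cobracket (B.toDual ξ) (B.toDual η))

theorem toDual_lie (ξ η : B.DualAlg) (u : 𝔤) :
    B.toDual ⁅ξ, η⁆ u = - B.cobracket u (B.toDual ξ) (B.toDual η) := rfl

theorem dual_ext {ξ η : B.DualAlg} (h : ∀ u, B.toDual ξ u = B.toDual η u) : ξ = η :=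
  B.toDual.injective (LinearMap.ext h)

instance : LieRing B.DualAlg where
  add_lie ξ η ζ := B.dual_ext fun u => by
    simp only [toDual_lie, map_add, LinearMap.add_apply]; ring
  lie_add ξ η ζ := B.dual_ext fun u => by
    simp only [toDual_lie, map_add, LinearMap.add_apply]; ring
  lie_self ξ := B.dual_ext fun u => by
    simp [toDual_lie, B.alt]
  leibniz_lie ξ η ζ := B.dual_ext fun u => by
    have h := LinearMap.congr_fun (B.jacobi (B.toDual ξ) (B.toDual η) (B.toDual ζ)) u
    change B.toDual ⁅⁅ξ, η⁆, ζ⁆ u + B.toDual ⁅⁅η, ζ⁆, ξ⁆ u + B.toDual ⁅⁅ζ, ξ⁆, η⁆ u = 0 at h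
    have h' : B.toDual ⁅ζ, ξ⁆ = - B.toDual ⁅ξ, ζ⁆ := by
      ext w
      simp only [LinearMap.neg_apply, toDual_lie]
      rw [B.cobracket_swap]
    simp only [map_add, LinearMap.add_apply]
    simp only [toDual_lie _ ⁅_, _⁆, toDual_lie _ _ ⁅_, _⁆, h', map_neg, LinearMap.neg_apply]
      at h ⊢
    rw [B.cobracket_swap u (B.toDual ⁅η, ζ⁆), B.cobracket_swap u (B.toDual ⁅ξ, ζ⁆)] at h
    linarith

instance : LieAlgebra ℝ B.DualAlg where
  lie_smul t ξ η := B.dual_ext fun u => by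
    simp [toDual_lie]

variable [FiniteDimensional ℝ 𝔤]

/-- The element of `𝔤` represented by a linear form on `𝔤*`. -/
def ofBidual : Module.Dual ℝ B.DualAlg ≃ₗ[ℝ] 𝔤 :=
  (B.toDual.dualMap.symm).trans (Module.evalEquiv ℝ 𝔤).symm

@[simp] theorem toDual_ofBidual (ξ : B.DualAlg) (a : Module.Dual ℝ B.DualAlg) :
    B.toDual ξ (B.ofBidual a) = a ξ := by
  have : Module.evalEquiv ℝ 𝔤 (B.ofBidual a) = B.toDual.dualMap.symm a := by
    simp [ofBidual]
  have h2 := LinearMap.congr_fun this (B.toDual ξ)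
  simpa using h2

theorem ofBidual_eq (a : Module.Dual ℝ B.DualAlg) (u : 𝔤)
    (h : ∀ ξ, a ξ = B.toDual ξ u) : B.ofBidual a = u := by
  apply (Module.evalEquiv ℝ 𝔤).injective
  ext ξ
  have := B.toDual_ofBidual (B.toDual.symm ξ) a
  simp only [LinearEquiv.apply_symm_apply] at this
  simp [this, h]

/-- The map `δ : 𝔤* → ⋀² 𝔤*`, `δ(ξ)(u₁, u₂) = - ξ([u₁, u₂])`, where `u₁, u₂ ∈ 𝔤` are regarded
as linear forms on `𝔤*`. -/
def dualCobracket : B.DualAlg →ₗ[ℝ] LinearMap.BilinForm ℝ (Module.Dual ℝ B.DualAlg) :=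
  LinearMap.mk₂ ℝ (fun ξ a => -(B.toDual ξ ∘ₗ
      (LieAlgebra.ad ℝ 𝔤 (B.ofBidual a) : 𝔤 →ₗ[ℝ] 𝔤) ∘ₗ B.ofBidual.toLinearMap))
    (by intros; ext; simp; ring) (by intros; ext; simp)
    (by intros; ext; simp; ring) (by intros; ext; simp)

theorem dualCobracket_apply (ξ : B.DualAlg) (a b : Module.Dual ℝ B.DualAlg) :
    B.dualCobracket ξ a b = - B.toDual ξ ⁅B.ofBidual a, B.ofBidual b⁆ := rfl

theorem ofBidual_cobracketDual (a b : Module.Dual ℝ B.DualAlg) :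
    B.ofBidual (cobracketDual B.dualCobracket a b) = ⁅B.ofBidual a, B.ofBidual b⁆ :=
  B.ofBidual_eq _ _ fun ξ => by simp [cobracketDual, dualCobracket_apply]

theorem toDual_lie_ofBidual (ζ χ : B.DualAlg) (c : Module.Dual ℝ B.DualAlg) (x : 𝔤) :
    B.toDual ζ ⁅B.ofBidual (c ∘ₗ (LieAlgebra.ad ℝ B.DualAlg χ : B.DualAlg →ₗ[ℝ] B.DualAlg)), x⁆ =
      B.cobracket (B.ofBidual c) (B.toDual χ)
        (B.toDual ζ ∘ₗ (LieAlgebra.ad ℝ 𝔤 x : 𝔤 →ₗ[ℝ] 𝔤)) := by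
  have h := B.toDual_ofBidual (B.toDual.symm
    (B.toDual ζ ∘ₗ (LieAlgebra.ad ℝ 𝔤 x : 𝔤 →ₗ[ℝ] 𝔤)))
    (c ∘ₗ (LieAlgebra.ad ℝ B.DualAlg χ : B.DualAlg →ₗ[ℝ] B.DualAlg))
  simp only [LinearEquiv.apply_symm_apply, LinearMap.comp_apply, LieAlgebra.ad_apply] at h
  rw [← lie_skew, map_neg, h, ← B.toDual_ofBidual, toDual_lie]
  simp

/-- The dual Lie bialgebra `(𝔤*, δ)`. -/
def dual : LieBialgebra B.DualAlg where
  cobracket := B.dualCobracket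
  alt := by intros; simp [dualCobracket_apply]
  jacobi := by
    intro a b c
    apply B.ofBidual.injective
    simp only [map_add, ofBidual_cobracketDual, map_zero]
    have h := lie_jacobi (B.ofBidual a) (B.ofBidual b) (B.ofBidual c)
    rw [← lie_skew ⁅B.ofBidual a, B.ofBidual b⁆, ← lie_skew ⁅B.ofBidual b, B.ofBidual c⁆,
      ← lie_skew ⁅B.ofBidual c, B.ofBidual a⁆, ← neg_eq_zero, ← h]
    abel
  cocycle := by
    intro ξ η a b
    simp only [dualCobracket_apply]
    rw [← lie_skew (B.ofBidual a) (B.ofBidual (b ∘ₗ _)),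
      ← lie_skew (B.ofBidual a) (B.ofBidual (b ∘ₗ _)), map_neg, map_neg]
    simp only [toDual_lie_ofBidual]
    rw [toDual_lie, B.cocycle, B.cobracket_swap (B.ofBidual a) _ (B.toDual η),
      B.cobracket_swap (B.ofBidual b) _ (B.toDual η)]
    ring

/-- The vector space `𝔡 = 𝔤 ⊕ 𝔤*` underlying the Drinfeld double. -/
def Double (B : LieBialgebra 𝔤) : Type _ := 𝔤 × B.DualAlg

instance : AddCommGroup B.Double := inferInstanceAs (AddCommGroup (𝔤 × B.DualAlg))
instance : Module ℝ B.Double := inferInstanceAs (Module ℝ (𝔤 × B.DualAlg))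

/-- The inclusion `𝔤 → 𝔡`. -/
def inl : 𝔤 →ₗ[ℝ] B.Double := LinearMap.inl ℝ 𝔤 B.DualAlg

/-- The inclusion `𝔤* → 𝔡`. -/
def inr : B.DualAlg →ₗ[ℝ] B.Double := LinearMap.inr ℝ 𝔤 B.DualAlg

/-- The projection `𝔡 → 𝔤`. -/
def prg : B.Double →ₗ[ℝ] 𝔤 := LinearMap.fst ℝ 𝔤 B.DualAlg

/-- The projection `𝔡 → 𝔤*`. -/
def prgs : B.Double →ₗ[ℝ] B.DualAlg := LinearMap.snd ℝ 𝔤 B.DualAlg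

/-- The pairing `⟨u + ξ, w + η⟩ = η(u) + ξ(w)` on `𝔡`. -/
def pairing : LinearMap.BilinForm ℝ B.Double :=
  LinearMap.mk₂ ℝ (fun a b => B.toDual (B.prgs b) (B.prg a) + B.toDual (B.prgs a) (B.prg b))
    (by intros; simp only [map_add, LinearMap.add_apply]; ring)
    (by intros; simp only [map_smul, LinearMap.smul_apply, smul_eq_mul]; ring)
    (by intros; simp only [map_add, LinearMap.add_apply]; ring)
    (by intros; simp only [map_smul, LinearMap.smul_apply, smul_eq_mul]; ring)

/-- `ad_u^* ξ ∈ 𝔤*`, given by `(ad_u^* ξ)(w) = ξ([w, u])`. -/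
def coad (u : 𝔤) (ξ : B.DualAlg) : B.DualAlg :=
  B.toDual.symm (-(B.toDual ξ ∘ₗ (LieAlgebra.ad ℝ 𝔤 u : 𝔤 →ₗ[ℝ] 𝔤)))

theorem coad_apply (u : 𝔤) (ξ : B.DualAlg) (w : 𝔤) :
    B.toDual (B.coad u ξ) w = B.toDual ξ ⁅w, u⁆ := by
  rw [← lie_skew, map_neg]; rfl

/-- `ad_ξ^* u ∈ 𝔤`, given by `η(ad_ξ^* u) = [η, ξ](u)`. -/
def coadDual (ξ : B.DualAlg) (u : 𝔤) : 𝔤 :=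
  B.ofBidual (-((LinearMap.applyₗ u) ∘ₗ B.toDual.toLinearMap ∘ₗ
    (LieAlgebra.ad ℝ B.DualAlg ξ : B.DualAlg →ₗ[ℝ] B.DualAlg)))

theorem coadDual_apply (ξ : B.DualAlg) (u : 𝔤) (η : B.DualAlg) :
    B.toDual η (B.coadDual ξ u) = B.toDual ⁅η, ξ⁆ u := by
  rw [coadDual, toDual_ofBidual, ← lie_skew, map_neg]; rfl

/-- The bracket of the Drinfeld double:
`[u + ξ, w + η] = [u, w] + ad_ξ^* w - ad_η^* u + [ξ, η] + ad_u^* η - ad_w^* ξ`. -/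
instance : Bracket B.Double B.Double where
  bracket a b :=
    (⁅B.prg a, B.prg b⁆ + B.coadDual (B.prgs a) (B.prg b) - B.coadDual (B.prgs b) (B.prg a),
     ⁅B.prgs a, B.prgs b⁆ + B.coad (B.prg a) (B.prgs b) - B.coad (B.prg b) (B.prgs a))

theorem prg_lie (a b : B.Double) : B.prg ⁅a, b⁆ =
    ⁅B.prg a, B.prg b⁆ + B.coadDual (B.prgs a) (B.prg b) - B.coadDual (B.prgs b) (B.prg a) := rfl

theorem prgs_lie (a b : B.Double) : B.prgs ⁅a, b⁆ =
    ⁅B.prgs a, B.prgs b⁆ + B.coad (B.prg a) (B.prgs b) - B.coad (B.prg b) (B.prgs a) := rfl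

theorem double_ext {a b : B.Double} (h₁ : ∀ ξ, B.toDual ξ (B.prg a) = B.toDual ξ (B.prg b))
    (h₂ : ∀ u, B.toDual (B.prgs a) u = B.toDual (B.prgs b) u) : a = b := by
  refine Prod.ext ?_ (B.dual_ext h₂)
  change B.prg a = B.prg b
  apply (Module.evalEquiv ℝ 𝔤).injective
  ext ξ
  simpa using h₁ (B.toDual.symm ξ)

theorem cocycle_coad (u w : 𝔤) (ξ η : B.DualAlg) :
    B.cobracket ⁅u, w⁆ (B.toDual ξ) (B.toDual η) =
      -(B.cobracket w (B.toDual (B.coad u ξ)) (B.toDual η) +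
        B.cobracket w (B.toDual ξ) (B.toDual (B.coad u η))) +
      (B.cobracket u (B.toDual (B.coad w ξ)) (B.toDual η) +
        B.cobracket u (B.toDual ξ) (B.toDual (B.coad w η))) := by
  have h : ∀ (x : 𝔤) (ζ : B.DualAlg), B.toDual ζ ∘ₗ (LieAlgebra.ad ℝ 𝔤 x : 𝔤 →ₗ[ℝ] 𝔤) =
      - B.toDual (B.coad x ζ) := fun x ζ => by simp [coad]
  rw [B.cocycle, h, h, h, h]
  simp only [map_neg, LinearMap.neg_apply]
  ring

theorem pairing_apply (a b : B.Double) : B.pairing a b =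
    B.toDual (B.prgs b) (B.prg a) + B.toDual (B.prgs a) (B.prg b) := rfl

theorem pairing_lie (a b c : B.Double) : B.pairing ⁅a, b⁆ c = B.pairing a ⁅b, c⁆ := by
  simp only [pairing_apply, prg_lie, prgs_lie, map_add, map_sub, LinearMap.add_apply,
    LinearMap.sub_apply, coad_apply, coadDual_apply, toDual_lie]
  rw [← lie_skew (B.prg c) (B.prg a), ← lie_skew (B.prg c) (B.prg b), map_neg, map_neg,
    B.cobracket_swap (B.prg b) (B.toDual (B.prgs c)),
    B.cobracket_swap (B.prg a) (B.toDual (B.prgs c))]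
  ring

theorem double_skew (a b : B.Double) : ⁅a, b⁆ = -⁅b, a⁆ := by
  apply B.double_ext <;> intro x
  · rw [map_neg, prg_lie, prg_lie, ← lie_skew (B.prg a)]; congr 1; abel
  · rw [map_neg, prgs_lie, prgs_lie, ← lie_skew (B.prgs a)]; congr 2; abel

theorem pairing_nondeg {a b : B.Double} (h : ∀ d, B.pairing a d = B.pairing b d) : a = b := by
  apply B.double_ext <;> intro x
  · have h1 := h (B.inr x)
    rw [pairing_apply, pairing_apply, show B.prg (B.inr x) = 0 from rfl,
      show B.prgs (B.inr x) = x from rfl] at h1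
    simpa using h1
  · have h1 := h (B.inl x)
    rw [pairing_apply, pairing_apply, show B.prg (B.inl x) = x from rfl,
      show B.prgs (B.inl x) = 0 from rfl] at h1
    simpa using h1

theorem pairing_jacobi (a b c d : B.Double) :
    B.pairing ⁅a, b⁆ ⁅c, d⁆ + B.pairing ⁅b, c⁆ ⁅a, d⁆ + B.pairing ⁅c, a⁆ ⁅b, d⁆ = 0 := by
  obtain ⟨u, hu⟩ : ∃ u, B.prg a = u := ⟨_, rfl⟩
  obtain ⟨v, hv⟩ : ∃ u, B.prg b = u := ⟨_, rfl⟩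
  obtain ⟨w, hw⟩ : ∃ u, B.prg c = u := ⟨_, rfl⟩
  obtain ⟨x, hx⟩ : ∃ u, B.prg d = u := ⟨_, rfl⟩
  obtain ⟨α, hα⟩ : ∃ u, B.prgs a = u := ⟨_, rfl⟩
  obtain ⟨β, hβ⟩ : ∃ u, B.prgs b = u := ⟨_, rfl⟩
  obtain ⟨γ, hγ⟩ : ∃ u, B.prgs c = u := ⟨_, rfl⟩
  obtain ⟨δ, hδ⟩ : ∃ u, B.prgs d = u := ⟨_, rfl⟩
  have jac : ∀ (ζ : B.DualAlg) (p q r : 𝔤), B.toDual ζ ⁅⁅p, q⁆, r⁆ + B.toDual ζ ⁅⁅q, r⁆, p⁆ +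
      B.toDual ζ ⁅⁅r, p⁆, q⁆ = 0 := fun ζ p q r => by
    have h := congrArg (B.toDual ζ) (lie_jacobi p q r)
    rw [← lie_skew ⁅p, q⁆, ← lie_skew ⁅q, r⁆, ← lie_skew ⁅r, p⁆]
    simp only [map_add, map_neg, map_zero] at h ⊢
    linarith
  have jac' : ∀ (ζ : B.DualAlg) (p q r : 𝔤), B.toDual ζ ⁅⁅p, q⁆, r⁆ + B.toDual ζ ⁅⁅q, r⁆, p⁆ -
      B.toDual ζ ⁅⁅p, r⁆, q⁆ = 0 := fun ζ p q r => by
    have h := jac ζ p q r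
    rw [← lie_skew r p, neg_lie, map_neg] at h
    linarith
  have djac : ∀ (p : 𝔤) (ζ η χ : B.DualAlg), B.toDual ⁅⁅ζ, η⁆, χ⁆ p + B.toDual ⁅⁅η, χ⁆, ζ⁆ p +
      B.toDual ⁅⁅χ, ζ⁆, η⁆ p = 0 := fun p ζ η χ =>
    LinearMap.congr_fun (B.jacobi (B.toDual ζ) (B.toDual η) (B.toDual χ)) p
  have djac' : ∀ (p : 𝔤) (ζ η χ : B.DualAlg), B.toDual ⁅⁅ζ, η⁆, χ⁆ p + B.toDual ⁅⁅η, χ⁆, ζ⁆ p -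
      B.toDual ⁅⁅ζ, χ⁆, η⁆ p = 0 := fun p ζ η χ => by
    have h := djac p ζ η χ
    rw [← lie_skew χ ζ, neg_lie, map_neg, LinearMap.neg_apply] at h
    linarith
  have swap : ∀ (p q : 𝔤) (ζ η : B.DualAlg), B.toDual ⁅ζ, B.coad p η⁆ q =
      - B.toDual ⁅B.coad p η, ζ⁆ q := fun p q ζ η => by
    rw [← lie_skew, map_neg, LinearMap.neg_apply]
  have coc : ∀ (p q : 𝔤) (ζ η : B.DualAlg), B.toDual ⁅ζ, η⁆ ⁅p, q⁆ =
      - B.toDual ⁅B.coad p ζ, η⁆ q + B.toDual ⁅B.coad p η, ζ⁆ q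
      + B.toDual ⁅B.coad q ζ, η⁆ p - B.toDual ⁅B.coad q η, ζ⁆ p := fun p q ζ η => by
    have h := B.cocycle_coad p q ζ η
    have e1 := swap p q ζ η
    have e2 := swap q p ζ η
    simp only [toDual_lie] at e1 e2 ⊢
    linarith
  simp only [pairing_apply, prg_lie, prgs_lie, map_add, map_sub, LinearMap.add_apply,
    LinearMap.sub_apply, coad_apply, coadDual_apply, hu, hv, hw, hx, hα, hβ, hγ, hδ, coc]
  linear_combination jac δ u v w - jac' γ u v x - jac' α v w x - jac' β w u x +
    djac x α β γ - djac' w α β δ - djac' u β γ δ - djac' v γ α δ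

instance : LieRing B.Double where
  add_lie a b c := by
    apply B.double_ext <;> intro x <;>
    simp only [prg_lie, prgs_lie, map_add, map_sub, LinearMap.add_apply, LinearMap.sub_apply,
      coad_apply, coadDual_apply, add_lie, lie_add] <;> ring
  lie_add a b c := by
    apply B.double_ext <;> intro x <;>
    simp only [prg_lie, prgs_lie, map_add, map_sub, LinearMap.add_apply, LinearMap.sub_apply,
      coad_apply, coadDual_apply, lie_add] <;> ring
  lie_self a := by
    apply B.double_ext <;> intro x <;>
    simp [prg_lie, prgs_lie]
  leibniz_lie a b c := B.pairing_nondeg fun d => by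
    have h := B.pairing_jacobi a b c d
    rw [B.double_skew a ⁅b, c⁆, B.double_skew b ⁅a, c⁆]
    rw [B.double_skew c a] at h
    simp only [map_add, LinearMap.add_apply, map_neg, LinearMap.neg_apply, pairing_lie] at h ⊢
    linarith

instance : LieAlgebra ℝ B.Double where
  lie_smul t a b := by
    apply B.double_ext <;> intro x <;>
    simp only [prg_lie, prgs_lie, map_add, map_sub, LinearMap.add_apply, LinearMap.sub_apply,
      coad_apply, coadDual_apply, map_smul, LinearMap.smul_apply, lie_smul,
      smul_eq_mul] <;> ring

end LieBialgebra

/-! ### Poisson structures and Poisson Lie groups -/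

namespace PoissonLie

section Manifold

variable (E : Type*) [NormedAddCommGroup E] [NormedSpace ℝ E]
  (M : Type*) [TopologicalSpace M] [ChartedSpace E M]

/-- A field of contravariant `2`-tensors on `M`, given at each point as a bilinear form on the
cotangent space. -/
abbrev TensorField : Type _ :=
  ∀ x : M, LinearMap.BilinForm ℝ (Module.Dual ℝ (TangentSpace 𝓘(ℝ, E) x))

variable {M}

/-- The differential of a function, as a covector. -/
def dfun (f : M → ℝ) (x : M) : Module.Dual ℝ (TangentSpace 𝓘(ℝ, E) x) :=
  (mfderiv 𝓘(ℝ, E) 𝓘(ℝ, ℝ) f x : TangentSpace 𝓘(ℝ, E) x →L[ℝ] ℝ).toLinearMap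

variable {E}

/-- The bracket `{f, h} = π(df, dh)`. -/
def poissonBracket (π : TensorField E M) (f h : M → ℝ) (x : M) : ℝ :=
  π x (dfun E f x) (dfun E h x)

/-- `f` is smooth near `x`. -/
abbrev SmoothAt (E : Type*) [NormedAddCommGroup E] [NormedSpace ℝ E] {M : Type*}
    [TopologicalSpace M] [ChartedSpace E M] (f : M → ℝ) (x : M) : Prop :=
  ContMDiffAt 𝓘(ℝ, E) 𝓘(ℝ, ℝ) ∞ f x

/-- `π` is a Poisson structure: a skew-symmetric and smooth tensor field (i.e. a bivector field)
such that `{f, h} = π(df, dh)` satisfies the Jacobi identity, for all (locally defined) smooth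
functions. -/
structure IsPoisson (π : TensorField E M) : Prop where
  alt : ∀ x α, π x α α = 0
  smooth : ∀ x f h, SmoothAt E f x → SmoothAt E h x → SmoothAt E (poissonBracket π f h) x
  jacobi : ∀ x f g h, SmoothAt E f x → SmoothAt E g x → SmoothAt E h x →
    poissonBracket π f (poissonBracket π g h) x + poissonBracket π g (poissonBracket π h f) x +
      poissonBracket π h (poissonBracket π f g) x = 0

end Manifold

section Group

variable {E : Type*} [NormedAddCommGroup E] [NormedSpace ℝ E]
  {G : Type*} [TopologicalSpace G] [ChartedSpace E G] [Group G]

variable (E) in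
/-- The differential at `x` of the left translation `l_g`. -/
def dLeft (g x : G) : TangentSpace 𝓘(ℝ, E) x →ₗ[ℝ] TangentSpace 𝓘(ℝ, E) (g * x) :=
  (mfderiv 𝓘(ℝ, E) 𝓘(ℝ, E) (fun y : G => g * y) x).toLinearMap

variable (E) in
/-- The differential at `x` of the right translation `r_g`. -/
def dRight (g x : G) : TangentSpace 𝓘(ℝ, E) x →ₗ[ℝ] TangentSpace 𝓘(ℝ, E) (x * g) :=
  (mfderiv 𝓘(ℝ, E) 𝓘(ℝ, E) (fun y : G => y * g) x).toLinearMap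

variable (E) in
/-- The differential at the identity of `l_g`, with target `T_g G`. -/
def leftTriv (g : G) : GroupLieAlgebra 𝓘(ℝ, E) G →ₗ[ℝ] TangentSpace 𝓘(ℝ, E) g :=
  dLeft E g 1

variable (E) in
/-- The differential at the identity of `r_g`, with target `T_g G`. -/
def rightTriv (g : G) : GroupLieAlgebra 𝓘(ℝ, E) G →ₗ[ℝ] TangentSpace 𝓘(ℝ, E) g :=
  dRight E g 1

variable (E) in
/-- The differential of `r_{g⁻¹}` at `g`, with target `T_e G`. -/
def rightTrivInv (g : G) : TangentSpace 𝓘(ℝ, E) g →ₗ[ℝ] GroupLieAlgebra 𝓘(ℝ, E) G :=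
  dRight E g⁻¹ g

variable (E) in
/-- The adjoint action of `G` on `T_e G`: the differential at `e` of `x ↦ g x g⁻¹`. -/
def Ad (g : G) : GroupLieAlgebra 𝓘(ℝ, E) G →ₗ[ℝ] GroupLieAlgebra 𝓘(ℝ, E) G :=
  (mfderiv 𝓘(ℝ, E) 𝓘(ℝ, E) (fun x : G => g * x * g⁻¹) 1).toLinearMap

/-- The right invariant vector field `u^r`. -/
def rightInvariantVectorField (u : GroupLieAlgebra 𝓘(ℝ, E) G) (g : G) :
    TangentSpace 𝓘(ℝ, E) g :=
  rightTriv E g u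

variable (E G) in
/-- An identification of the Lie algebra of `G` with `𝔞`. The convention is that the bracket on
`T_e G` is the bracket of *right* invariant vector fields (the opposite of Mathlib's bracket on
`GroupLieAlgebra`). -/
structure LieAlgebraIdent (𝔞 : Type*) [LieRing 𝔞] [LieAlgebra ℝ 𝔞] where
  /-- the underlying linear isomorphism -/
  equiv : 𝔞 ≃ₗ[ℝ] GroupLieAlgebra 𝓘(ℝ, E) G
  map_lie : ∀ a b : 𝔞, equiv ⁅a, b⁆ =
    VectorField.mlieBracket 𝓘(ℝ, E) (rightInvariantVectorField (equiv a))
      (rightInvariantVectorField (equiv b)) (1 : G)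

/-- The adjoint action of `G` on `𝔞`, when `𝔞` is identified with the Lie algebra of `G`. -/
def LieAlgebraIdent.Ad {𝔞 : Type*} [LieRing 𝔞] [LieAlgebra ℝ 𝔞] (e : LieAlgebraIdent E G 𝔞)
    (g : G) : 𝔞 →ₗ[ℝ] 𝔞 :=
  e.equiv.symm.toLinearMap ∘ₗ PoissonLie.Ad E g ∘ₗ e.equiv.toLinearMap

/-- `π_{gh} = l_g(π_h) + r_h(π_g)`. -/
def IsMultiplicative (π : TensorField E G) : Prop :=
  ∀ (g h : G) (α β : Module.Dual ℝ (TangentSpace 𝓘(ℝ, E) (g * h))),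
    π (g * h) α β = π h (α ∘ₗ dLeft E g h) (β ∘ₗ dLeft E g h) +
      π g (α ∘ₗ dRight E h g) (β ∘ₗ dRight E h g)

/-- `(G, π)` is a Poisson Lie group. -/
structure IsPoissonLieGroup [LieGroup 𝓘(ℝ, E) ∞ G] (π : TensorField E G) : Prop where
  poisson : IsPoisson π
  multiplicative : IsMultiplicative π

/-- The value at `g` of the right trivialized tensor field `r_{g⁻¹}(π_g)` on two covectors
at the identity. -/
def rightTrivialized (π : TensorField E G)
    (α β : Module.Dual ℝ (GroupLieAlgebra 𝓘(ℝ, E) G)) (g : G) : ℝ :=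
  π g (α ∘ₗ rightTrivInv E g) (β ∘ₗ rightTrivInv E g)

/-- The Lie algebra of `G` being identified with `𝔤`, the Lie bialgebra of `(G, π)` is `B`: the
linearization of `π` at `e`, i.e. the derivative at `e` of `g ↦ r_{g⁻¹}(π_g)`, is the cobracket
of `B`. -/
def HasLieBialgebra {𝔤 : Type*} [LieRing 𝔤] [LieAlgebra ℝ 𝔤] (e : LieAlgebraIdent E G 𝔤)
    (π : TensorField E G) (B : LieBialgebra 𝔤) : Prop :=
  ∀ α β : Module.Dual ℝ (GroupLieAlgebra 𝓘(ℝ, E) G),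
    MDifferentiableAt 𝓘(ℝ, E) 𝓘(ℝ, ℝ) (rightTrivialized π α β) 1 ∧
    ∀ u : 𝔤, dfun E (rightTrivialized π α β) 1 (e.equiv u) =
      B.cobracket u (α ∘ₗ e.equiv.toLinearMap) (β ∘ₗ e.equiv.toLinearMap)

/-- `(G', π')` is a dual Poisson Lie group of the Poisson Lie group `(G, π)` with Lie bialgebra
`B`: it is a Poisson Lie group with Lie bialgebra `B.dual`. -/
structure IsDualPoissonLieGroup {𝔤 : Type*} [LieRing 𝔤] [LieAlgebra ℝ 𝔤] [FiniteDimensional ℝ 𝔤]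
    {E' : Type*} [NormedAddCommGroup E'] [NormedSpace ℝ E']
    {G' : Type*} [TopologicalSpace G'] [ChartedSpace E' G'] [Group G']
    [LieGroup 𝓘(ℝ, E) ∞ G] [LieGroup 𝓘(ℝ, E') ∞ G']
    (B : LieBialgebra 𝔤)
    (e : LieAlgebraIdent E G 𝔤) (π : TensorField E G)
    (e' : LieAlgebraIdent E' G' B.DualAlg) (π' : TensorField E' G') : Prop where
  poissonLie : IsPoissonLieGroup π
  bialgebra : HasLieBialgebra e π B
  poissonLie' : IsPoissonLieGroup π'
  bialgebra' : HasLieBialgebra e' π' B.dual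

variable {E' : Type*} [NormedAddCommGroup E'] [NormedSpace ℝ E']
  {D : Type*} [TopologicalSpace D] [ChartedSpace E' D] [Group D]

variable (E E') in
/-- The differential of `φ : G → D` at `g`. -/
def dmap (φ : G → D) (g : G) :
    TangentSpace 𝓘(ℝ, E) g →ₗ[ℝ] TangentSpace 𝓘(ℝ, E') (φ g) :=
  (mfderiv 𝓘(ℝ, E) 𝓘(ℝ, E') φ g).toLinearMap

variable (E E') in
/-- The differential of a group homomorphism at the identity. -/
def dmapOne (φ : G →* D) : GroupLieAlgebra 𝓘(ℝ, E) G →ₗ[ℝ] GroupLieAlgebra 𝓘(ℝ, E') D :=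
  dmap E E' φ 1

/-- `φ : (G, π) → (D, ϖ)` is a homomorphism of Poisson Lie groups: a smooth group homomorphism
between Poisson Lie groups that is a Poisson map. -/
structure IsPoissonLieGroupHom [LieGroup 𝓘(ℝ, E) ∞ G] [LieGroup 𝓘(ℝ, E') ∞ D]
    (π : TensorField E G) (ϖ : TensorField E' D) (φ : G →* D) : Prop where
  source : IsPoissonLieGroup π
  target : IsPoissonLieGroup ϖ
  smooth : ContMDiff 𝓘(ℝ, E) 𝓘(ℝ, E') ∞ φ
  map : ∀ (g : G) (α β : Module.Dual ℝ (TangentSpace 𝓘(ℝ, E') (φ g))),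
    ϖ (φ g) α β = π g (α ∘ₗ dmap E E' φ g) (β ∘ₗ dmap E E' φ g)

/-- `φ : G → D` is an integration of the linear map `f : 𝔞 → 𝔟` of Lie algebras: a smooth group
homomorphism whose differential at the identity is `f`. -/
structure IsIntegration {𝔞 𝔟 : Type*} [LieRing 𝔞] [LieAlgebra ℝ 𝔞] [LieRing 𝔟] [LieAlgebra ℝ 𝔟]
    (e : LieAlgebraIdent E G 𝔞) (e' : LieAlgebraIdent E' D 𝔟) (f : 𝔞 →ₗ[ℝ] 𝔟)
    (φ : G →* D) : Prop where
  smooth : ContMDiff 𝓘(ℝ, E) 𝓘(ℝ, E') ∞ φ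
  deriv : ∀ a : 𝔞, dmapOne E E' φ (e.equiv a) = e'.equiv (f a)

end Group

/-! ### The bivector fields on `D`, `G` and `G*` -/

section Double

variable {𝔤 : Type*} [LieRing 𝔤] [LieAlgebra ℝ 𝔤] [FiniteDimensional ℝ 𝔤] (B : LieBialgebra 𝔤)
  {ED : Type*} [NormedAddCommGroup ED] [NormedSpace ℝ ED]
  {D : Type*} [TopologicalSpace D] [ChartedSpace ED D] [Group D]
  {EG : Type*} [NormedAddCommGroup EG] [NormedSpace ℝ EG]
  {G : Type*} [TopologicalSpace G] [ChartedSpace EG G] [Group G]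

/-- The bivector `a ∧ b = a ⊗ b - b ⊗ a`, evaluated on pairs of covectors. -/
def wedge {V : Type*} [AddCommGroup V] [Module ℝ V] (a b : V) :
    LinearMap.BilinForm ℝ (Module.Dual ℝ V) :=
  LinearMap.BilinForm.linMulLin (Module.Dual.eval ℝ V a) (Module.Dual.eval ℝ V b) -
    LinearMap.BilinForm.linMulLin (Module.Dual.eval ℝ V b) (Module.Dual.eval ℝ V a)

/-- `R = ½ ∑ ξ_i ∧ u_i ∈ ⋀² 𝔡`, where `u_i` is a basis of `𝔤` and `ξ_i` the dual basis. -/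
def rmatrix {ι : Type*} [Fintype ι] (u : Module.Basis ι ℝ 𝔤) :
    LinearMap.BilinForm ℝ (Module.Dual ℝ B.Double) :=
  (1 / 2 : ℝ) • ∑ i, wedge (B.inr (B.toDual.symm (u.coord i))) (B.inl (u i))

/-- `D` integrates the quadratic Lie algebra `(𝔡, ⟨ , ⟩)`: its Lie algebra is identified with `𝔡`
in such a way that the adjoint action preserves the pairing. -/
structure QuadraticIdent (ED : Type*) [NormedAddCommGroup ED] [NormedSpace ℝ ED]
    (D : Type*) [TopologicalSpace D] [ChartedSpace ED D] [Group D]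
    extends LieAlgebraIdent ED D B.Double where
  pairing_Ad : ∀ (d : D) (a b : B.Double),
    B.pairing (toLieAlgebraIdent.Ad d a) (toLieAlgebraIdent.Ad d b) = B.pairing a b

variable {B}

/-- `π_D = R^r - R^l`. -/
def piD (eD : QuadraticIdent B ED D) {ι : Type*} [Fintype ι] (u : Module.Basis ι ℝ 𝔤) :
    TensorField ED D := fun d =>
  (rmatrix B u).compl₁₂ (rightTriv ED d ∘ₗ eD.equiv.toLinearMap).dualMap
      (rightTriv ED d ∘ₗ eD.equiv.toLinearMap).dualMap -
    (rmatrix B u).compl₁₂ (leftTriv ED d ∘ₗ eD.equiv.toLinearMap).dualMap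
      (leftTriv ED d ∘ₗ eD.equiv.toLinearMap).dualMap

/-- The covector `α` at `g` is `ξ^l|_g` for the element `ξ = leftCoord eG g α` of `𝔤*`. -/
def leftCoord (eG : LieAlgebraIdent EG G 𝔤) (g : G) :
    Module.Dual ℝ (TangentSpace 𝓘(ℝ, EG) g) →ₗ[ℝ] B.DualAlg :=
  B.toDual.symm.toLinearMap ∘ₗ (leftTriv EG g ∘ₗ eG.equiv.toLinearMap).dualMap

/-- The covector `α` at `v` is `u^r|_v` for the element `u = rightCoord eS v α` of `𝔤 = (𝔤*)*`. -/
def rightCoord (eS : LieAlgebraIdent EG G B.DualAlg) (v : G) :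
    Module.Dual ℝ (TangentSpace 𝓘(ℝ, EG) v) →ₗ[ℝ] 𝔤 :=
  B.ofBidual.toLinearMap ∘ₗ (rightTriv EG v ∘ₗ eS.equiv.toLinearMap).dualMap

/-- `π_G|_g(ξ₁^l, ξ₂^l) = ⟨pr_𝔤(Ad_{φ(g)} ξ₁), pr_𝔤*(Ad_{φ(g)} ξ₂)⟩`. -/
def piG (eD : QuadraticIdent B ED D) (eG : LieAlgebraIdent EG G 𝔤) (φ : G →* D) :
    TensorField EG G := fun g =>
  B.pairing.compl₁₂
    (B.inl ∘ₗ B.prg ∘ₗ eD.Ad (φ g) ∘ₗ B.inr ∘ₗ leftCoord eG g)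
    (B.inr ∘ₗ B.prgs ∘ₗ eD.Ad (φ g) ∘ₗ B.inr ∘ₗ leftCoord eG g)

/-- `π_G*|_v(u₁^r, u₂^r) = ⟨pr_𝔤(Ad_{φ(v)⁻¹} u₁), pr_𝔤*(Ad_{φ(v)⁻¹} u₂)⟩`. -/
def piGs (eD : QuadraticIdent B ED D) (eS : LieAlgebraIdent EG G B.DualAlg) (φ : G →* D) :
    TensorField EG G := fun v =>
  B.pairing.compl₁₂
    (B.inl ∘ₗ B.prg ∘ₗ eD.Ad (φ v)⁻¹ ∘ₗ B.inl ∘ₗ rightCoord eS v)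
    (B.inr ∘ₗ B.prgs ∘ₗ eD.Ad (φ v)⁻¹ ∘ₗ B.inl ∘ₗ rightCoord eS v)

end Double

end PoissonLie

end

/-! Let p be the projection of 𝔡 onto 𝔤 along 𝔤*, and put q_d = Ad_d p Ad_d⁻¹. Contracted with the
pairing, R becomes ⟨p a, b⟩ - ½⟨a, b⟩ (`rmatrix_pairing`), and the symmetric half drops out of R^r -
R^l because Ad preserves the pairing. Hence, in the right trivialization, π_D at d is the skew
operator p - q_d (`skewOp`).

The same operator governs all three groups. Let ψ : H → D have differential ι, and let a covector at
g ∈ H be represented by any a ∈ 𝔡 for which ⟨a, ι ·⟩ gives its values on right invariant fields.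
Then π_G and π_G* are ε⟨(p - q_{ψ(g)}) a, b⟩ with ε = 1 and ε = -1 respectively. For G this uses
that Ad_{φ(g)} preserves 𝔤, for G* that it preserves 𝔤*, and in both cases that the two subalgebras
are isotropic. The predicate `IsInduced` records this description, established in `isInduced_piD`,
`isInduced_piG` and `isInduced_piGs`; every assertion is then deduced from it.

Multiplicativity holds because d ↦ p - q_d is a group cocycle (`skewOp_mul`). The homomorphisms are
Poisson because an element of 𝔡 representing a covector on D also represents its pullback, so the
two formulas coincide. The Lie bialgebras come from differentiating Ad_{d⁻¹} at the identity, which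
produces the bracket of right invariant fields (`mder_AdE_inv_one`).

For the Jacobi identity, each differential is represented by a gradient in 𝔡. The operator p - q
maps it into the image of ι, so Hamiltonian derivatives are derivatives along right invariant
fields. Second derivatives of the functions combine into commutators, which `rd_rbr` reduces to
first order. What remains is an algebraic identity for the two splittings attached to p and q,
`IsLagrangianProj.jacobi`; it uses only that the kernels and images are isotropic subalgebras and
that the pairing is invariant. -/

noncomputable section

namespace PoissonLie

open VectorField Set Filter Topology

/-! ### Derivatives on manifolds: parameter dependence, charts, brackets of vector fields. -/

section
variable {E : Type*} [NormedAddCommGroup E] [NormedSpace ℝ E]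
  {M : Type*} [TopologicalSpace M] [ChartedSpace E M]
  {E' : Type*} [NormedAddCommGroup E'] [NormedSpace ℝ E']
  {M' : Type*} [TopologicalSpace M'] [ChartedSpace E' M']
  {E'' : Type*} [NormedAddCommGroup E''] [NormedSpace ℝ E'']
  {N : Type*} [TopologicalSpace N] [ChartedSpace E'' N]
  {F : Type*} [NormedAddCommGroup F] [NormedSpace ℝ F]

theorem two_le_infty : (2 : ℕ∞ω) ≤ ∞ := WithTop.coe_le_coe.2 (le_top : (2 : ℕ∞) ≤ ⊤)

variable (E E') in
/-- The derivative of a map of manifolds, as a continuous linear map of the model spaces. -/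
def mder (f : M → M') (x : M) : E →L[ℝ] E' := mfderiv 𝓘(ℝ, E) 𝓘(ℝ, E') f x

theorem mder_comp {g : M' → N} {f : M → M'} {x : M}
    (hg : MDifferentiableAt 𝓘(ℝ, E') 𝓘(ℝ, E'') g (f x))
    (hf : MDifferentiableAt 𝓘(ℝ, E) 𝓘(ℝ, E') f x) :
    mder E E'' (fun y => g (f y)) x = (mder E' E'' g (f x)).comp (mder E E' f x) :=
  mfderiv_comp x hg hf

theorem mder_eq_fderiv (f : E → F) (x : E) : mder E F f x = fderiv ℝ f x := mfderiv_eq_fderiv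

theorem mder_congr {f g : M → M'} {x : M} (h : f =ᶠ[𝓝 x] g) : mder E E' f x = mder E E' g x :=
  h.mfderiv_eq

theorem mder_id (x : M) : mder E E (fun y : M => y) x = ContinuousLinearMap.id ℝ E :=
  mfderiv_id

theorem mder_const (c : M') (x : M) : mder E E' (fun _ : M => c) x = 0 := mfderiv_const

/-- Base point and image point do not move with the parameter, so the coordinate changes in
`inTangentCoordinates` are identities and the trivialized derivative is the derivative itself. -/
theorem contMDiffAt_mder_of_const [IsManifold 𝓘(ℝ, E) ∞ M] [IsManifold 𝓘(ℝ, E') ∞ M']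
    [IsManifold 𝓘(ℝ, E'') ∞ N] {Φ : N → M → M'} {x₀ : N} {m : M} {m' : M'}
    (h : ContMDiffAt (𝓘(ℝ, E'').prod 𝓘(ℝ, E)) 𝓘(ℝ, E') ∞ (Function.uncurry Φ) (x₀, m))
    (hm : ∀ x, Φ x m = m') :
    ContMDiffAt 𝓘(ℝ, E'') 𝓘(ℝ, E →L[ℝ] E') ∞ (fun x => mder E E' (Φ x) m) x₀ := by
  have : IsManifold 𝓘(ℝ, E) 1 M := .of_le (n := ∞) (by simp)
  have : IsManifold 𝓘(ℝ, E') 1 M' := .of_le (n := ∞) (by simp)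
  have : IsManifold 𝓘(ℝ, E'') 1 N := .of_le (n := ∞) (by simp)
  have h1 : ContMDiffAt 𝓘(ℝ, E'') 𝓘(ℝ, E →L[ℝ] E') ∞ (inTangentCoordinates 𝓘(ℝ, E) 𝓘(ℝ, E')
      (fun _ => m) (fun x => Φ x m) (fun x => mder E E' (Φ x) m) x₀) x₀ :=
    ContMDiffAt.mfderiv (m := ∞) Φ (fun _ => m) h contMDiffAt_const (by simp)
  refine h1.congr_of_eventuallyEq (Eventually.of_forall fun x => ?_)
  change mder E E' (Φ x) m = _
  rw [inTangentCoordinates_eq (x₀ := x₀) (x := x) _ _ _ (mem_chart_source _ _) (by simp [hm])]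
  ext v
  simp only [ContinuousLinearMap.comp_apply]
  rw [(tangentBundleCore 𝓘(ℝ, E) M).coordChange_self _ _ (mem_chart_source _ _)]
  rw [hm x, hm x₀, (tangentBundleCore 𝓘(ℝ, E') M').coordChange_self _ _ (mem_chart_source _ _)]

theorem contMDiffAt_mder_vec [IsManifold 𝓘(ℝ, E) ∞ M]
    [IsManifold 𝓘(ℝ, E'') ∞ N] {Φ : N → M → F} {x₀ : N} {m : M}
    (h : ContMDiffAt (𝓘(ℝ, E'').prod 𝓘(ℝ, E)) 𝓘(ℝ, F) ∞ (Function.uncurry Φ) (x₀, m)) :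
    ContMDiffAt 𝓘(ℝ, E'') 𝓘(ℝ, E →L[ℝ] F) ∞
      (fun x => mder E F (Φ x) m) x₀ := by
  have : IsManifold 𝓘(ℝ, E) 1 M := .of_le (n := ∞) (by simp)
  have : IsManifold 𝓘(ℝ, E'') 1 N := .of_le (n := ∞) (by simp)
  have h1 : ContMDiffAt 𝓘(ℝ, E'') 𝓘(ℝ, E →L[ℝ] F) ∞ (inTangentCoordinates 𝓘(ℝ, E) 𝓘(ℝ, F)
      (fun _ => m) (fun x => Φ x m) (fun x => mder E F (Φ x) m) x₀) x₀ :=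
    ContMDiffAt.mfderiv (m := ∞) Φ (fun _ => m) h contMDiffAt_const (by simp)
  refine h1.congr_of_eventuallyEq (Eventually.of_forall fun x => ?_)
  change mder E F (Φ x) m = _
  rw [inTangentCoordinates_eq (x₀ := x₀) (x := x) _ _ _ (mem_chart_source _ _) (mem_univ _)]
  ext v
  simp only [ContinuousLinearMap.comp_apply]
  rw [(tangentBundleCore 𝓘(ℝ, E) M).coordChange_self _ _ (mem_chart_source _ _)]
  rw [tangentBundleCore_coordChange_model_space]
  rfl

/-- The derivative of a vector valued map, computed in the preferred chart. -/
theorem mder_eq_fderiv_extChartAt {f : M → F} {x : M}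
    (hf : MDifferentiableAt 𝓘(ℝ, E) 𝓘(ℝ, F) f x) :
    mder E F f x = fderiv ℝ (fun y => f ((extChartAt 𝓘(ℝ, E) x).symm y)) (extChartAt 𝓘(ℝ, E) x x) := by
  refine (MDifferentiableAt.mfderiv hf).trans ?_
  rw [← fderivWithin_univ, ← range_id]
  rfl

theorem mder_extChartAt [IsManifold 𝓘(ℝ, E) ∞ M] (x : M) :
    mder E E (extChartAt 𝓘(ℝ, E) x) x = ContinuousLinearMap.id ℝ E := by
  have : IsManifold 𝓘(ℝ, E) 1 M := .of_le (n := ∞) (by simp)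
  rw [mder_eq_fderiv_extChartAt (mdifferentiableAt_extChartAt (mem_chart_source _ _))]
  have : (fun y => extChartAt 𝓘(ℝ, E) x ((extChartAt 𝓘(ℝ, E) x).symm y))
    =ᶠ[𝓝 (extChartAt 𝓘(ℝ, E) x x)] id := by
    filter_upwards [extChartAt_target_mem_nhds (I := 𝓘(ℝ, E)) x] with y hy
    exact (extChartAt 𝓘(ℝ, E) x).right_inv hy
  rw [this.fderiv_eq, fderiv_id]

theorem isInvertible_mder_extChartAt_symm [IsManifold 𝓘(ℝ, E) ∞ M] {x : M} {y : E}
    (hy : y ∈ (extChartAt 𝓘(ℝ, E) x).target) :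
    (mder E E (extChartAt 𝓘(ℝ, E) x).symm y).IsInvertible := by
  have : IsManifold 𝓘(ℝ, E) 1 M := .of_le (n := ∞) (by simp)
  have h := isInvertible_mfderivWithin_extChartAt_symm hy
  rw [ModelWithCorners.range_eq_univ, mfderivWithin_univ] at h
  exact h

theorem mdifferentiableAt_extChartAt_symm [IsManifold 𝓘(ℝ, E) ∞ M] {x : M} {y : E}
    (hy : y ∈ (extChartAt 𝓘(ℝ, E) x).target) :
    MDifferentiableAt 𝓘(ℝ, E) 𝓘(ℝ, E) (extChartAt 𝓘(ℝ, E) x).symm y := by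
  have : IsManifold 𝓘(ℝ, E) 1 M := .of_le (n := ∞) (by simp)
  have h := mdifferentiableWithinAt_extChartAt_symm hy
  rwa [ModelWithCorners.range_eq_univ, mdifferentiableWithinAt_univ] at h

theorem mder_extChartAt_symm [IsManifold 𝓘(ℝ, E) ∞ M] (x : M) :
    mder E E (extChartAt 𝓘(ℝ, E) x).symm (extChartAt 𝓘(ℝ, E) x x) = ContinuousLinearMap.id ℝ E := by
  have : IsManifold 𝓘(ℝ, E) 1 M := .of_le (n := ∞) (by simp)
  have h := mder_comp (g := (extChartAt 𝓘(ℝ, E) x).symm) (f := extChartAt 𝓘(ℝ, E) x) (x := x)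
    (mdifferentiableAt_extChartAt_symm (mem_extChartAt_target x))
    (mdifferentiableAt_extChartAt (mem_chart_source _ _))
  rw [mder_extChartAt, ContinuousLinearMap.comp_id] at h
  rw [← h, ← mder_id x]
  apply mder_congr
  filter_upwards [extChartAt_source_mem_nhds (I := 𝓘(ℝ, E)) x] with y hy
  exact (extChartAt 𝓘(ℝ, E) x).left_inv hy

/-- In the preferred chart at x this is the vector space formula for the derivative along a Lie
bracket, which rests on the symmetry of second derivatives. -/
theorem mder_apply_mlieBracket [IsManifold 𝓘(ℝ, E) ∞ M] [CompleteSpace E]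
    {V W : ∀ x : M, TangentSpace 𝓘(ℝ, E) x} {f : M → F} {x : M}
    (hf : ContMDiffAt 𝓘(ℝ, E) 𝓘(ℝ, F) ∞ f x)
    (hV : MDifferentiableAt 𝓘(ℝ, E) 𝓘(ℝ, E).tangent (fun y => (V y : TangentBundle 𝓘(ℝ, E) M)) x)
    (hW : MDifferentiableAt 𝓘(ℝ, E) 𝓘(ℝ, E).tangent (fun y => (W y : TangentBundle 𝓘(ℝ, E) M)) x)
    (hVf : MDifferentiableAt 𝓘(ℝ, E) 𝓘(ℝ, F) (fun y => mder E F f y (V y)) x)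
    (hWf : MDifferentiableAt 𝓘(ℝ, E) 𝓘(ℝ, F) (fun y => mder E F f y (W y)) x) :
    mder E F f x (mlieBracket 𝓘(ℝ, E) V W x) =
      mder E F (fun y => mder E F f y (W y)) x (V x) -
      mder E F (fun y => mder E F f y (V y)) x (W x) := by
  have : IsManifold 𝓘(ℝ, E) 1 M := .of_le (n := ∞) (by simp)
  have : IsManifold 𝓘(ℝ, E) 2 M := .of_le (n := ∞) two_le_infty
  set φ := extChartAt 𝓘(ℝ, E) x with hφ
  set c := φ x with hc
  -- For the pullback of U to the chart: it is differentiable, the derivative of f along it is the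
  -- pulled back function, and at the centre it has the value U x because the chart has identity
  -- derivative there.
  have key : ∀ U : ∀ x : M, TangentSpace 𝓘(ℝ, E) x,
      MDifferentiableAt 𝓘(ℝ, E) 𝓘(ℝ, E).tangent (fun y => (U y : TangentBundle 𝓘(ℝ, E) M)) x →
      DifferentiableAt ℝ (fun y => (mder E E φ.symm y).inverse (U (φ.symm y))) c ∧
      (fun y => fderiv ℝ (fun z => f (φ.symm z)) y ((mder E E φ.symm y).inverse (U (φ.symm y))))
        =ᶠ[𝓝 c] (fun y => mder E F f (φ.symm y) (U (φ.symm y))) ∧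
      (mder E E φ.symm c).inverse (U (φ.symm c)) = U x := by
    intro U hU
    refine ⟨?_, ?_, ?_⟩
    · have h := MDifferentiableWithinAt.differentiableWithinAt_mpullbackWithin_vectorField
        (mdifferentiableWithinAt_univ.2 hU)
      rw [preimage_univ, univ_inter, ModelWithCorners.range_eq_univ, mpullbackWithin_univ] at h
      exact differentiableWithinAt_univ.1 h
    · have hd : ∀ᶠ y in 𝓝 c, MDifferentiableAt 𝓘(ℝ, E) 𝓘(ℝ, F) f (φ.symm y) := by
        have h1 : ∀ᶠ y in 𝓝 x, MDifferentiableAt 𝓘(ℝ, E) 𝓘(ℝ, F) f y := by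
          have := (contMDiffAt_iff_contMDiffAt_nhds (n := 1) (by simp)).1 (hf.of_le (by simp))
          filter_upwards [this] with y hy using hy.mdifferentiableAt (by simp)
        have h2 : Tendsto φ.symm (𝓝 c) (𝓝 x) := by
          have := continuousAt_extChartAt_symm (I := 𝓘(ℝ, E)) x
          rwa [ContinuousAt, extChartAt_to_inv] at this
        exact h2.eventually h1
      filter_upwards [hd, extChartAt_target_mem_nhds (I := 𝓘(ℝ, E)) x] with y hy hy'
      rw [← mder_eq_fderiv, mder_comp hy (mdifferentiableAt_extChartAt_symm hy')]
      obtain ⟨e, he⟩ := isInvertible_mder_extChartAt_symm hy'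
      rw [← hφ] at he
      rw [← he, ContinuousLinearMap.inverse_equiv]
      exact congrArg (mder E F f (φ.symm y)) (e.apply_symm_apply _)
    · rw [hc, hφ, mder_extChartAt_symm, ContinuousLinearMap.inverse_id, extChartAt_to_inv]
      rfl
  obtain ⟨V1, V2, V3⟩ := key V hV
  obtain ⟨W1, W2, W3⟩ := key W hW
  have e : mlieBracket 𝓘(ℝ, E) V W x = lieBracket ℝ
      (fun y => (mder E E φ.symm y).inverse (V (φ.symm y)))
      (fun y => (mder E E φ.symm y).inverse (W (φ.symm y))) c := by
    rw [← mlieBracketWithin_univ, mlieBracketWithin_apply]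
    simp only [preimage_univ, univ_inter, ModelWithCorners.range_eq_univ, mpullbackWithin_univ]
    have : (mder E E φ x).inverse = ContinuousLinearMap.id ℝ E := by
      rw [mder_extChartAt, ContinuousLinearMap.inverse_id]
    rw [← lieBracketWithin_univ]
    exact congrArg (fun T : E →L[ℝ] E => T _) this
  have hfc : ContDiffAt ℝ ∞ (fun y => f (φ.symm y)) c := by
    have h := (contMDiffAt_iff.1 hf).2
    rw [ModelWithCorners.range_eq_univ] at h
    exact contDiffWithinAt_univ.1 h
  have hlb := fderiv_apply_lieBracket (n := ∞) hfc (by simpa using two_le_infty) W1 V1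
  rw [mder_eq_fderiv_extChartAt (hf.mdifferentiableAt (by simp)), mder_eq_fderiv_extChartAt hVf,
    mder_eq_fderiv_extChartAt hWf, ← V2.fderiv_eq, ← W2.fderiv_eq, e, hlb, V3, W3]
end

/-! ### Symmetry of mixed derivatives on a product of manifolds. -/

section
variable {E : Type*} [NormedAddCommGroup E] [NormedSpace ℝ E]
  {M : Type*} [TopologicalSpace M] [ChartedSpace E M]
  {E' : Type*} [NormedAddCommGroup E'] [NormedSpace ℝ E']
  {M' : Type*} [TopologicalSpace M'] [ChartedSpace E' M']
  {F : Type*} [NormedAddCommGroup F] [NormedSpace ℝ F]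

theorem fderiv_fderiv_fst_snd {Ψ : E × E' → F} {c : E} {c' : E'} (h : ContDiffAt ℝ ∞ Ψ (c, c'))
    (v : E) (w : E') :
    fderiv ℝ (fun s => fderiv ℝ (fun t => Ψ (s, t)) c' w) c v =
      fderiv ℝ (fderiv ℝ Ψ) (c, c') (v, 0) (0, w) := by
  have hd : ∀ᶠ p in 𝓝 (c, c'), DifferentiableAt ℝ Ψ p := by
    filter_upwards [(h.of_le two_le_infty).eventually (by simp)] with p hp
    exact hp.differentiableAt (by simp)
  have hc : Tendsto (fun s : E => (s, c')) (𝓝 c) (𝓝 (c, c')) :=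
    (Continuous.prodMk_left c').tendsto c
  have h1 : (fun s => fderiv ℝ (fun t => Ψ (s, t)) c' w) =ᶠ[𝓝 c]
      fun s => fderiv ℝ Ψ (s, c') (0, w) := by
    filter_upwards [hc.eventually hd] with s hs
    have := (hs.hasFDerivAt.comp c' (hasFDerivAt_prodMk_right s c')).fderiv
    exact congrArg (fun T : E' →L[ℝ] F => T w) this
  have h2 : DifferentiableAt ℝ (fderiv ℝ Ψ) (c, c') :=
    ((h.of_le two_le_infty).fderiv_right (m := 1) (by norm_num)).differentiableAt (by simp)
  have h3 := (HasFDerivAt.comp (g := fderiv ℝ Ψ) (f := fun s : E => (s, c')) c h2.hasFDerivAt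
    (hasFDerivAt_prodMk_left c c')).clm_apply
    (hasFDerivAt_const ((0 : E), w) c)
  rw [h1.fderiv_eq]
  have h4 := congrArg (fun T : E →L[ℝ] F => T v) h3.fderiv
  simpa using h4

theorem fderiv_fderiv_snd_fst {Ψ : E × E' → F} {c : E} {c' : E'} (h : ContDiffAt ℝ ∞ Ψ (c, c'))
    (v : E) (w : E') :
    fderiv ℝ (fun t => fderiv ℝ (fun s => Ψ (s, t)) c v) c' w =
      fderiv ℝ (fderiv ℝ Ψ) (c, c') (0, w) (v, 0) := by
  have hd : ∀ᶠ p in 𝓝 (c, c'), DifferentiableAt ℝ Ψ p := by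
    filter_upwards [(h.of_le two_le_infty).eventually (by simp)] with p hp
    exact hp.differentiableAt (by simp)
  have hc : Tendsto (fun t : E' => (c, t)) (𝓝 c') (𝓝 (c, c')) :=
    (Continuous.prodMk_right c).tendsto c'
  have h1 : (fun t => fderiv ℝ (fun s => Ψ (s, t)) c v) =ᶠ[𝓝 c']
      fun t => fderiv ℝ Ψ (c, t) (v, 0) := by
    filter_upwards [hc.eventually hd] with s hs
    have := (HasFDerivAt.comp (g := Ψ) (f := fun t : E => (t, s)) c hs.hasFDerivAt
      (hasFDerivAt_prodMk_left c s)).fderiv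
    exact congrArg (fun T : E →L[ℝ] F => T v) this
  have h2 : DifferentiableAt ℝ (fderiv ℝ Ψ) (c, c') :=
    ((h.of_le two_le_infty).fderiv_right (m := 1) (by norm_num)).differentiableAt (by simp)
  have h3 := (HasFDerivAt.comp (g := fderiv ℝ Ψ) (f := fun t : E' => (c, t)) c' h2.hasFDerivAt
    (hasFDerivAt_prodMk_right c c')).clm_apply
    (hasFDerivAt_const (v, (0 : E')) c')
  rw [h1.fderiv_eq]
  have h4 := congrArg (fun T : E' →L[ℝ] F => T w) h3.fderiv
  simpa using h4

theorem contMDiffAt_extChartAt_symm_self [IsManifold 𝓘(ℝ, E) ∞ M] (x : M) :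
    ContMDiffAt 𝓘(ℝ, E) 𝓘(ℝ, E) ∞ (extChartAt 𝓘(ℝ, E) x).symm (extChartAt 𝓘(ℝ, E) x x) :=
  (contMDiffOn_extChartAt_symm x).contMDiffAt (extChartAt_target_mem_nhds x)

/-- Both sides are entries of the second derivative of Φ read in the product of two charts. This
cancels the second order terms in `mder_AdE_inv_one`. -/
theorem mder_mder_comm [IsManifold 𝓘(ℝ, E) ∞ M] [IsManifold 𝓘(ℝ, E') ∞ M'] {Φ : M → M' → F}
    {m : M} {m' : M'}
    (h : ContMDiffAt (𝓘(ℝ, E).prod 𝓘(ℝ, E')) 𝓘(ℝ, F) ∞ (Function.uncurry Φ) (m, m')) (v : E)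
      (w : E') :
    mder E F (fun y => mder E' F (Φ y) m' w) m v =
      mder E' F (fun z => mder E F (fun y => Φ y z) m v) m' w := by
  have : IsManifold 𝓘(ℝ, E) 1 M := .of_le (n := ∞) (by simp)
  have : IsManifold 𝓘(ℝ, E') 1 M' := .of_le (n := ∞) (by simp)
  set φ := extChartAt 𝓘(ℝ, E) m with hφ
  set φ' := extChartAt 𝓘(ℝ, E') m' with hφ'
  have hm : φ.symm (φ m) = m := extChartAt_to_inv m
  have hm' : φ'.symm (φ' m') = m' := extChartAt_to_inv m'
  have hΨ : ContDiffAt ℝ ∞ (fun p : E × E' => Φ (φ.symm p.1) (φ'.symm p.2)) (φ m, φ' m') := by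
    rw [← contMDiffAt_iff_contDiffAt]
    refine ContMDiffAt.comp (I' := 𝓘(ℝ, E).prod 𝓘(ℝ, E')) (g := Function.uncurry Φ)
      (f := fun p : E × E' => (φ.symm p.1, φ'.symm p.2)) (φ m, φ' m') ?_ ?_
    · simpa [hm, hm'] using h
    · refine ContMDiffAt.prodMk ?_ ?_
      · exact ContMDiffAt.comp (φ m, φ' m') (contMDiffAt_extChartAt_symm_self m)
          contDiff_fst.contMDiff.contMDiffAt
      · exact ContMDiffAt.comp (φ m, φ' m') (contMDiffAt_extChartAt_symm_self m')
          contDiff_snd.contMDiff.contMDiffAt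
  have hsw : ContMDiffAt (𝓘(ℝ, E').prod 𝓘(ℝ, E)) 𝓘(ℝ, F) ∞
      (Function.uncurry (fun z y => Φ y z)) (m', m) :=
    ContMDiffAt.comp (m', m) (g := Function.uncurry Φ) (f := Prod.swap) h
      (contMDiffAt_snd.prodMk contMDiffAt_fst)
  have hn : ∀ᶠ p in 𝓝 (m, m'), MDifferentiableAt (𝓘(ℝ, E).prod 𝓘(ℝ, E')) 𝓘(ℝ, F)
      (Function.uncurry Φ) p := by
    have := (contMDiffAt_iff_contMDiffAt_nhds (n := 1) (by simp)).1 (h.of_le (by simp))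
    filter_upwards [this] with y hy using hy.mdifferentiableAt (by simp)
  have h1 : MDifferentiableAt 𝓘(ℝ, E) 𝓘(ℝ, F) (fun y => mder E' F (Φ y) m' w) m :=
    ((contMDiffAt_mder_vec h).clm_apply contMDiffAt_const).mdifferentiableAt (by simp)
  have h2 : MDifferentiableAt 𝓘(ℝ, E') 𝓘(ℝ, F) (fun z => mder E F (fun y => Φ y z) m v) m' :=
    ((contMDiffAt_mder_vec hsw).clm_apply contMDiffAt_const).mdifferentiableAt (by simp)
  rw [mder_eq_fderiv_extChartAt h1, mder_eq_fderiv_extChartAt h2]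
  have e1 : (fun y => mder E' F (Φ (φ.symm y)) m' w) =ᶠ[𝓝 (φ m)]
      fun y => fderiv ℝ (fun t => Φ (φ.symm y) (φ'.symm t)) (φ' m') w := by
    have ht : Tendsto (fun y => (φ.symm y, m')) (𝓝 (φ m)) (𝓝 (m, m')) := by
      refine Tendsto.prodMk_nhds ?_ tendsto_const_nhds
      have := (contMDiffAt_extChartAt_symm_self (E := E) m).continuousAt
      rwa [ContinuousAt, extChartAt_to_inv] at this
    filter_upwards [ht.eventually hn] with y hy
    rw [mder_eq_fderiv_extChartAt]
    exact hy.comp m' (mdifferentiableAt_const.prodMk mdifferentiableAt_id)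
  have e2 : (fun z => mder E F (fun y => Φ y (φ'.symm z)) m v) =ᶠ[𝓝 (φ' m')]
      fun z => fderiv ℝ (fun s => Φ (φ.symm s) (φ'.symm z)) (φ m) v := by
    have ht : Tendsto (fun z => (m, φ'.symm z)) (𝓝 (φ' m')) (𝓝 (m, m')) := by
      refine Tendsto.prodMk_nhds tendsto_const_nhds ?_
      have := (contMDiffAt_extChartAt_symm_self (E := E') m').continuousAt
      rwa [ContinuousAt, extChartAt_to_inv] at this
    filter_upwards [ht.eventually hn] with y hy
    rw [mder_eq_fderiv_extChartAt]
    exact hy.comp m (f := fun y' => (y', φ'.symm y)) (mdifferentiableAt_id.prodMk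
      mdifferentiableAt_const)
  rw [e1.fderiv_eq, e2.fderiv_eq, fderiv_fderiv_fst_snd hΨ, fderiv_fderiv_snd_fst hΨ]
  exact (hΨ.isSymmSndFDerivAt (by simpa using two_le_infty)) _ _

end
-- Right invariant derivatives and the adjoint action.
section
variable {E : Type*} [NormedAddCommGroup E] [NormedSpace ℝ E]
  {G : Type*} [TopologicalSpace G] [ChartedSpace E G] [Group G] [LieGroup 𝓘(ℝ, E) ∞ G]
open Bundle Function

/-- The field is the tangent map of multiplication applied to v at 1 and the zero vector at g, hence
a composite of smooth maps. -/
theorem contMDiff_rightInvariantVectorField (v : E) :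
    ContMDiff 𝓘(ℝ, E) 𝓘(ℝ, E).tangent ∞
      (fun g : G => (rightInvariantVectorField (E := E) (G := G) v g : TangentBundle 𝓘(ℝ, E) G)) := by
  have : IsManifold 𝓘(ℝ, E) 1 G := .of_le (n := ∞) (by simp)
  let fg : G → TangentBundle 𝓘(ℝ, E) G := fun g ↦ TotalSpace.mk' E g 0
  have sfg : ContMDiff 𝓘(ℝ, E) 𝓘(ℝ, E).tangent ∞ fg := contMDiff_zeroSection _ _
  let fv : G → TangentBundle 𝓘(ℝ, E) G := fun _ ↦ TotalSpace.mk' E 1 v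
  have sfv : ContMDiff 𝓘(ℝ, E) 𝓘(ℝ, E).tangent ∞ fv := contMDiff_const
  let F₁ : G → (TangentBundle 𝓘(ℝ, E) G × TangentBundle 𝓘(ℝ, E) G) := fun g ↦ (fv g, fg g)
  have S₁ : ContMDiff 𝓘(ℝ, E) (𝓘(ℝ, E).tangent.prod 𝓘(ℝ, E).tangent) ∞ F₁ := sfv.prodMk sfg
  let F₂ : (TangentBundle 𝓘(ℝ, E) G × TangentBundle 𝓘(ℝ, E) G) → TangentBundle
    (𝓘(ℝ, E).prod 𝓘(ℝ, E)) (G × G) :=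
    (equivTangentBundleProd 𝓘(ℝ, E) G 𝓘(ℝ, E) G).symm
  have S₂ : ContMDiff (𝓘(ℝ, E).tangent.prod 𝓘(ℝ, E).tangent) (𝓘(ℝ, E).prod 𝓘(ℝ, E)).tangent ∞ F₂ :=
    contMDiff_equivTangentBundleProd_symm
  let F₃ : TangentBundle (𝓘(ℝ, E).prod 𝓘(ℝ, E)) (G × G) → TangentBundle 𝓘(ℝ, E) G :=
    tangentMap (𝓘(ℝ, E).prod 𝓘(ℝ, E)) 𝓘(ℝ, E) (fun (p : G × G) ↦ p.1 * p.2)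
  have S₃ : ContMDiff (𝓘(ℝ, E).prod 𝓘(ℝ, E)).tangent 𝓘(ℝ, E).tangent ∞ F₃ := by
    apply ContMDiff.contMDiff_tangentMap _ (m := ∞) (n := ∞) (by simp)
    exact contMDiff_mul 𝓘(ℝ, E) ∞
  let S := (S₃.comp S₂).comp S₁
  refine S.congr fun g => ?_
  have key : mder E E (fun y : G => y * g) 1 v =
      mfderiv (𝓘(ℝ, E).prod 𝓘(ℝ, E)) 𝓘(ℝ, E) (fun p : G × G => p.1 * p.2) (1, g) ((v : E), (0 : E)) := by
    have hm : MDifferentiableAt (𝓘(ℝ, E).prod 𝓘(ℝ, E)) 𝓘(ℝ, E) (fun p : G × G => p.1 * p.2) (1, g) :=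
      (contMDiff_mul 𝓘(ℝ, E) ∞).mdifferentiableAt (by simp)
    refine Eq.trans ?_ (mfderiv_prod_eq_add_apply (v := ((v : E), (0 : E))) hm).symm
    have h0 : mder E E (fun y : G => 1 * y) g 0 = 0 := map_zero _
    exact ((congrArg (mder E E (fun y : G => y * g) 1 v + ·) h0).trans (add_zero _)).symm
  have aux : ∀ (p q : G) (a b : E), p = q → a = b →
      (TotalSpace.mk' E p a : TangentBundle 𝓘(ℝ, E) G) = TotalSpace.mk' E q b := by
    rintro p q a b rfl rfl; rfl
  exact aux g (1 * g) _ _ (one_mul g).symm key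

theorem mdiff_mul_right (g y : G) : MDifferentiableAt 𝓘(ℝ, E) 𝓘(ℝ, E) (fun y : G => y * g) y :=
  (contMDiff_mul_right (I := 𝓘(ℝ, E)) (n := ∞)).mdifferentiableAt (by simp)

theorem mdiff_mul_left (g y : G) : MDifferentiableAt 𝓘(ℝ, E) 𝓘(ℝ, E) (fun y : G => g * y) y :=
  (contMDiff_mul_left (I := 𝓘(ℝ, E)) (n := ∞)).mdifferentiableAt (by simp)

theorem mdiff_conj (g y : G) : MDifferentiableAt 𝓘(ℝ, E) 𝓘(ℝ, E) (fun y : G => g * y * g⁻¹) y :=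
  (mdiff_mul_right g⁻¹ (g * y)).comp y (mdiff_mul_left g y)

variable (E) in
/-- The differential at the identity of right translation by `g`. -/
def rt (g : G) : E →L[ℝ] E := mder E E (fun y : G => y * g) 1

variable (E) in
/-- The differential at the identity of left translation by `g`. -/
def lt (g : G) : E →L[ℝ] E := mder E E (fun y : G => g * y) 1

variable (E) in
/-- The adjoint action of `g` on the model space. -/
def AdE (g : G) : E →L[ℝ] E := mder E E (fun y : G => g * y * g⁻¹) 1

theorem rt_one : rt E (1 : G) = ContinuousLinearMap.id ℝ E := by
  simp only [rt, mul_one]; exact mder_id _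

theorem AdE_one : AdE E (1 : G) = ContinuousLinearMap.id ℝ E := by
  simp only [AdE, one_mul, inv_one, mul_one]; exact mder_id _

theorem AdE_mul (g h : G) : AdE E (g * h) = (AdE E g).comp (AdE E h) := by
  have := mder_comp (g := fun y : G => g * y * g⁻¹) (f := fun y : G => h * y * h⁻¹) (x := 1)
    (mdiff_conj (E := E) g _) (mdiff_conj (E := E) h _)
  simp only [mul_one, mul_inv_cancel] at this
  rw [AdE, AdE, AdE, ← this]
  congr 1; ext y; group

theorem rt_eq (g : G) : rt E g = (lt E g).comp (AdE E g⁻¹) := by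
  have := mder_comp (g := fun y : G => g * y) (f := fun y : G => g⁻¹ * y * g⁻¹⁻¹) (x := 1)
    (mdiff_mul_left (E := E) g _) (mdiff_conj (E := E) g⁻¹ _)
  simp only [mul_one, mul_inv_cancel] at this
  rw [lt, AdE, rt, ← this]
  congr 1; ext y; group

theorem lt_eq (g : G) : lt E g = (rt E g).comp (AdE E g) := by
  rw [rt_eq, ContinuousLinearMap.comp_assoc, ← AdE_mul, inv_mul_cancel, AdE_one,
    ContinuousLinearMap.comp_id]

theorem contMDiff_AdE : ContMDiff 𝓘(ℝ, E) 𝓘(ℝ, E →L[ℝ] E) ∞ (AdE E : G → E →L[ℝ] E) := by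
  intro g
  refine contMDiffAt_mder_of_const (Φ := fun g y : G => g * y * g⁻¹) (m' := 1) ?_ (by simp)
  exact ((contMDiff_fst.mul contMDiff_snd).mul contMDiff_fst.inv).contMDiffAt

variable {F : Type*} [NormedAddCommGroup F] [NormedSpace ℝ F]

variable (E) in
/-- The derivative of `f` along a right invariant vector field. -/
def rd (f : G → F) (u : E) (g : G) : F := mder E F f g (rt E g u)

/-- Moves the derivative from the varying point g to the fixed point 1, so that smoothness in g
becomes a statement about a derivative with parameters. -/
theorem rd_eq_mder {f : G → F} {g : G} (hf : MDifferentiableAt 𝓘(ℝ, E) 𝓘(ℝ, F) f g) (u : E) :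
    rd E f u g = mder E F (fun z => f (z * g)) 1 u := by
  have := mder_comp (g := f) (f := fun z : G => z * g) (x := 1)
    (by simpa using hf) (mdiff_mul_right (E := E) g _)
  rw [this, rd, rt]; simp

theorem mdiff_near {f : G → F} {g : G} (hf : ContMDiffAt 𝓘(ℝ, E) 𝓘(ℝ, F) ∞ f g) :
    ∀ᶠ y in 𝓝 g, MDifferentiableAt 𝓘(ℝ, E) 𝓘(ℝ, F) f y := by
  have : IsManifold 𝓘(ℝ, E) 1 G := .of_le (n := ∞) (by simp)
  have := (contMDiffAt_iff_contMDiffAt_nhds (n := 1) (by simp)).1 (hf.of_le (by simp))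
  filter_upwards [this] with y hy using hy.mdifferentiableAt (by simp)

theorem contMDiffAt_rd {f : G → F} {g : G} (hf : ContMDiffAt 𝓘(ℝ, E) 𝓘(ℝ, F) ∞ f g) (u : E) :
    ContMDiffAt 𝓘(ℝ, E) 𝓘(ℝ, F) ∞ (rd E f u) g := by
  have h1 : ContMDiffAt 𝓘(ℝ, E) 𝓘(ℝ, E →L[ℝ] F) ∞ (fun y => mder E F (fun z => f (z * y)) 1) g := by
    refine contMDiffAt_mder_vec (Φ := fun y z : G => f (z * y)) ?_
    refine ContMDiffAt.comp (g := f) (f := fun p : G × G => p.2 * p.1) (g, 1) (by simpa using hf) ?_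
    exact (contMDiff_snd.mul contMDiff_fst).contMDiffAt
  refine (h1.clm_apply (contMDiffAt_const (c := u))).congr_of_eventuallyEq ?_
  filter_upwards [mdiff_near hf] with y hy
  exact rd_eq_mder hy u

theorem contMDiffAt_comp_mul_right {f : G → F} {g h : G} (hf : ContMDiffAt 𝓘(ℝ, E) 𝓘(ℝ, F) ∞ f
    (h * g)) :
    ContMDiffAt 𝓘(ℝ, E) 𝓘(ℝ, F) ∞ (fun z => f (z * g)) h :=
  ContMDiffAt.comp (g := f) (f := fun z : G => z * g) h hf contMDiff_mul_right.contMDiffAt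

theorem rt_mul (g h : G) : rt E (g * h) = (mder E E (fun y : G => y * h) g).comp (rt E g) := by
  have := mder_comp (g := fun y : G => y * h) (f := fun z : G => z * g) (x := 1)
    (mdiff_mul_right (E := E) h _) (mdiff_mul_right (E := E) g _)
  simp only [one_mul, mul_assoc] at this
  exact this

theorem rd_comp_mul_right {f : G → F} {g h : G}
    (hf : MDifferentiableAt 𝓘(ℝ, E) 𝓘(ℝ, F) f (h * g)) (u : E) :
    rd E (fun z => f (z * g)) u h = rd E f u (h * g) := by
  have := mder_comp (g := f) (f := fun z : G => z * g) (x := h) hf (mdiff_mul_right (E := E) g _)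
  rw [rd, this, rd, rt_mul]; rfl

variable (E G) in
/-- The bracket of the right invariant vector fields with values `x` and `y` at the identity,
evaluated at the identity. -/
def rbr (x y : E) : E :=
  mlieBracket 𝓘(ℝ, E) (rightInvariantVectorField (E := E) (G := G) x)
      (rightInvariantVectorField (E := E) (G := G) y) (1 : G)

theorem mder_rbr_one [CompleteSpace E] {f : G → F} (hf : ContMDiffAt 𝓘(ℝ, E) 𝓘(ℝ, F) ∞ f 1)
    (x y : E) :
    mder E F f 1 (rbr E G x y) = mder E F (rd E f y) 1 x - mder E F (rd E f x) 1 y := by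
  have h := mder_apply_mlieBracket (V := rightInvariantVectorField (E := E) (G := G) x)
    (W := rightInvariantVectorField (E := E) (G := G) y) hf
    ((contMDiff_rightInvariantVectorField (E := E) (G := G) x).mdifferentiableAt (by simp))
    ((contMDiff_rightInvariantVectorField (E := E) (G := G) y).mdifferentiableAt (by simp))
    ((contMDiffAt_rd hf x).mdifferentiableAt (by simp))
    ((contMDiffAt_rd hf y).mdifferentiableAt (by simp))
  have e : ∀ z : E, rightInvariantVectorField (E := E) (G := G) z 1 = z := fun z =>
    congrArg (fun T : E →L[ℝ] E => T z) (rt_one (E := E) (G := G))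
  rw [e, e] at h
  exact h

/-- Right translation by g commutes with right invariant derivatives, so the case g = 1 applied to z
↦ f (z * g) suffices. -/
theorem rd_rbr [CompleteSpace E] {f : G → F} {g : G} (hf : ContMDiffAt 𝓘(ℝ, E) 𝓘(ℝ, F) ∞ f g)
    (x y : E) :
    rd E f (rbr E G x y) g = rd E (rd E f y) x g - rd E (rd E f x) y g := by
  have key : ∀ u : E, rd E (fun z => f (z * g)) u =ᶠ[𝓝 1] fun z => rd E f u (z * g) := by
    intro u
    have : Tendsto (fun z : G => z * g) (𝓝 1) (𝓝 g) := by
      have := (contMDiff_mul_right (I := 𝓘(ℝ, E)) (n := ∞) (a := g)).continuous.tendsto (1 : G)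
      rwa [one_mul] at this
    filter_upwards [this.eventually (mdiff_near hf)] with z hz
    exact rd_comp_mul_right hz u
  have h := mder_rbr_one (contMDiffAt_comp_mul_right (g := g) (h := 1) (by simpa using hf)) x y
  rw [rd_eq_mder (hf.mdifferentiableAt (by simp)), h, mder_congr (key x), mder_congr (key y),
    rd_eq_mder ((contMDiffAt_rd hf x).mdifferentiableAt (by simp)),
    rd_eq_mder ((contMDiffAt_rd hf y).mdifferentiableAt (by simp))]

end

/-! ### Product rule for operator valued functions. -/

section
variable {E : Type*} [NormedAddCommGroup E] [NormedSpace ℝ E]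
  {M : Type*} [TopologicalSpace M] [ChartedSpace E M] [IsManifold 𝓘(ℝ, E) ∞ M]
  {F : Type*} [NormedAddCommGroup F] [NormedSpace ℝ F]
  {F' : Type*} [NormedAddCommGroup F'] [NormedSpace ℝ F']

theorem hasFDerivAt_comp_extChartAt_symm {f : M → F} {x : M}
    (hf : MDifferentiableAt 𝓘(ℝ, E) 𝓘(ℝ, F) f x) :
    HasFDerivAt (fun y => f ((extChartAt 𝓘(ℝ, E) x).symm y)) (mder E F f x)
      (extChartAt 𝓘(ℝ, E) x x) := by
  rw [mder_eq_fderiv_extChartAt hf]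
  refine DifferentiableAt.hasFDerivAt ?_
  rw [← mdifferentiableAt_iff_differentiableAt]
  refine MDifferentiableAt.comp (g := f) (I' := 𝓘(ℝ, E)) _ ?_
    (mdifferentiableAt_extChartAt_symm (mem_extChartAt_target x))
  rwa [extChartAt_to_inv]

theorem mder_eq_of_hasFDerivAt {f : M → F} {x : M} {T : E →L[ℝ] F}
    (hf : MDifferentiableAt 𝓘(ℝ, E) 𝓘(ℝ, F) f x)
    (h : HasFDerivAt (fun y => f ((extChartAt 𝓘(ℝ, E) x).symm y)) T (extChartAt 𝓘(ℝ, E) x x)) :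
    mder E F f x = T :=
  (hasFDerivAt_comp_extChartAt_symm hf).unique h

theorem mder_clm_apply {L : M → F →L[ℝ] F'} {v : M → F} {x : M}
    (hL : MDifferentiableAt 𝓘(ℝ, E) 𝓘(ℝ, F →L[ℝ] F') L x)
    (hv : MDifferentiableAt 𝓘(ℝ, E) 𝓘(ℝ, F) v x) (w : E) :
    mder E F' (fun y => L y (v y)) x w = mder E (F →L[ℝ] F') L x w (v x) + L x (mder E F v x w) := by
  have h := (hasFDerivAt_comp_extChartAt_symm hL).clm_apply (hasFDerivAt_comp_extChartAt_symm hv)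
  rw [mder_eq_of_hasFDerivAt (hL.clm_apply hv) h]
  simp [add_comm]

theorem mder_clm_apply_const {L : M → F →L[ℝ] F'} {x : M}
    (hL : MDifferentiableAt 𝓘(ℝ, E) 𝓘(ℝ, F →L[ℝ] F') L x) (v : F) (w : E) :
    mder E F' (fun y => L y v) x w = mder E (F →L[ℝ] F') L x w v := by
  rw [mder_clm_apply hL mdifferentiableAt_const, mder_const]; simp
end
-- The derivative of the adjoint action.
section
variable {E : Type*} [NormedAddCommGroup E] [NormedSpace ℝ E]
  {G : Type*} [TopologicalSpace G] [ChartedSpace E G] [Group G] [LieGroup 𝓘(ℝ, E) ∞ G]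

theorem contMDiff_AdE_inv (a : E) :
    ContMDiff 𝓘(ℝ, E) 𝓘(ℝ, E) ∞ (fun y : G => AdE E y⁻¹ a) :=
  (contMDiff_AdE.comp (contMDiff_inv 𝓘(ℝ, E) ∞)).clm_apply contMDiff_const

/-- The bracket is tested on a function f. The derivative of f along a^r at y is the derivative of z
↦ f(yz) at 1 in the direction Ad_{y⁻¹} a, while along x^r at z it is that of y ↦ f(yz) at 1 in the
direction x. In the commutator the mixed second derivatives cancel, leaving df applied to the
derivative of Ad_{y⁻¹} a. The plus sign reflects the right invariant convention for the bracket. -/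
theorem mder_AdE_inv_one [CompleteSpace E] (x a : E) :
    mder E E (fun y : G => AdE E y⁻¹ a) 1 x = rbr E G x a := by
  have : IsManifold 𝓘(ℝ, E) 1 G := .of_le (n := ∞) (by simp)
  -- The chart at 1 serves as a vector valued test function; its derivative there is the identity,
  -- so no information is lost.
  obtain ⟨f, hf, hfd⟩ : ∃ f : G → E, ContMDiffAt 𝓘(ℝ, E) 𝓘(ℝ, E) ∞ f 1 ∧
      mder E E f 1 = ContinuousLinearMap.id ℝ E :=
    ⟨extChartAt 𝓘(ℝ, E) (1 : G), contMDiffAt_extChartAt, mder_extChartAt 1⟩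
  have h := mder_rbr_one hf x a
  have hΦ : ContMDiffAt (𝓘(ℝ, E).prod 𝓘(ℝ, E)) 𝓘(ℝ, E) ∞
      (Function.uncurry fun y z : G => f (y * z)) (1, 1) :=
    ContMDiffAt.comp (g := f) (f := fun p : G × G => p.1 * p.2) (1, 1) (by simpa using hf)
      (contMDiff_fst.mul contMDiff_snd).contMDiffAt
  have hΛ := (contMDiffAt_mder_vec hΦ).mdifferentiableAt (by simp)
  have e1 : rd E f a =ᶠ[𝓝 1] fun y => mder E E (fun z => f (y * z)) 1 (AdE E y⁻¹ a) := by
    filter_upwards [mdiff_near hf] with y hy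
    have := mder_comp (g := f) (f := fun z : G => y * z) (x := 1)
      (by simpa using hy) (mdiff_mul_left (E := E) y _)
    rw [this, rd, rt_eq, lt, mul_one]; rfl
  have e2 : rd E f x =ᶠ[𝓝 1] fun z => mder E E (fun y => f (y * z)) 1 x := by
    filter_upwards [mdiff_near hf] with y hy
    exact rd_eq_mder hy x
  rw [hfd, mder_congr e1, mder_congr e2,
    mder_clm_apply hΛ ((contMDiff_AdE_inv a).mdifferentiableAt (by simp)),
    ← mder_mder_comm hΦ x a, mder_clm_apply_const hΛ] at h
  simp only [inv_one, AdE_one, one_mul] at h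
  rw [hfd] at h
  simpa using h.symm

theorem mder_AdE_inv [CompleteSpace E] (g : G) (x a : E) :
    rd E (fun y : G => AdE E y⁻¹ a) x g = AdE E g⁻¹ (rbr E G x a) := by
  rw [rd_eq_mder ((contMDiff_AdE_inv a).mdifferentiableAt (by simp))]
  have e : (fun z : G => AdE E (z * g)⁻¹ a) = fun z => AdE E g⁻¹ (AdE E z⁻¹ a) := by
    ext z; rw [mul_inv_rev, AdE_mul]; rfl
  have h := mder_comp (g := AdE E g⁻¹) (f := fun z : G => AdE E z⁻¹ a) (x := 1)
    ((AdE E g⁻¹).differentiableAt.mdifferentiableAt)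
    ((contMDiff_AdE_inv a).mdifferentiableAt (by simp))
  rw [e, h, mder_eq_fderiv, ContinuousLinearMap.fderiv, ← mder_AdE_inv_one]; rfl

/-- Differentiate Ad_g Ad_{z⁻¹} a = Ad_{(g z g⁻¹)⁻¹} Ad_g a at z = 1. -/
theorem AdE_rbr [CompleteSpace E] (g : G) (x a : E) :
    AdE E g (rbr E G x a) = rbr E G (AdE E g x) (AdE E g a) := by
  have e : (fun z : G => AdE E g (AdE E z⁻¹ a)) =
      fun z : G => (fun y : G => AdE E y⁻¹ (AdE E g a)) (g * z * g⁻¹) := by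
    ext z
    change _ = AdE E (g * z * g⁻¹)⁻¹ (AdE E g a)
    rw [← ContinuousLinearMap.comp_apply, ← ContinuousLinearMap.comp_apply, ← AdE_mul, ← AdE_mul]
    congr 2; group
  have h := mder_comp (g := AdE E g) (f := fun z : G => AdE E z⁻¹ a) (x := 1)
    ((AdE E g).differentiableAt.mdifferentiableAt)
    ((contMDiff_AdE_inv a).mdifferentiableAt (by simp))
  have h' := mder_comp (g := fun y : G => AdE E y⁻¹ (AdE E g a)) (f := fun z : G => g * z * g⁻¹)
    (x := 1)
    ((contMDiff_AdE_inv _).mdifferentiableAt (by simp)) (mdiff_conj g 1)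
  rw [e, h', mder_eq_fderiv, ContinuousLinearMap.fderiv] at h
  have h2 := congrArg (fun T : E →L[ℝ] E => T x) h
  simp only [ContinuousLinearMap.comp_apply, mul_one, mul_inv_cancel] at h2
  rw [mder_AdE_inv_one, mder_AdE_inv_one] at h2
  exact h2.symm
end

/-! ### Lagrangian splittings of a quadratic Lie algebra. -/

section Lagrangian

variable {V : Type*} [LieRing V] [LieAlgebra ℝ V]

/-- `q` is the projection onto a Lagrangian subalgebra along another one. -/
structure IsLagrangianProj (κ : LinearMap.BilinForm ℝ V) (q : V →ₗ[ℝ] V) : Prop where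
  adj : ∀ a b, κ (q a) b = κ a b - κ a (q b)
  isotropic : ∀ a b c, κ (q a) ⁅q b, q c⁆ = 0
  isotropic' : ∀ a b c, κ (a - q a) ⁅b - q b, c - q c⁆ = 0

theorem IsLagrangianProj.conj {κ : LinearMap.BilinForm ℝ V} {q A A' : V →ₗ[ℝ] V}
    (hq : IsLagrangianProj κ q) (hA : ∀ a b, κ (A a) (A b) = κ a b)
      (hlie : ∀ a b, A ⁅a, b⁆ = ⁅A a, A b⁆)
    (hA' : ∀ a, A (A' a) = a) : IsLagrangianProj κ (A ∘ₗ q ∘ₗ A') where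
  adj a b := by
    have h1 : ∀ x y, κ (A x) y = κ x (A' y) := fun x y => by rw [← hA x, hA']
    have h2 : ∀ x y, κ y (A x) = κ (A' y) x := fun x y => by rw [← hA _ x, hA']
    have h3 : κ a b = κ (A' a) (A' b) := by
      rw [← hA (A' a), hA', hA']
    simp only [LinearMap.comp_apply, h1, h2, h3, hq.adj]
  isotropic a b c := by
    simp only [LinearMap.comp_apply, ← hlie, hA, hq.isotropic]
  isotropic' a b c := by
    have h : ∀ x, x - A (q (A' x)) = A (A' x - q (A' x)) := fun x => by rw [map_sub, hA']
    simp only [LinearMap.comp_apply, h, ← hlie, hA, hq.isotropic']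

/-- Isotropy makes ⟨pa, [pb, pc]⟩ + ⟨(1-p)a, [(1-p)b, (1-p)c]⟩ vanish, and likewise for q. In the
difference of these two expressions the term ⟨a, [b, c]⟩ cancels; in the cyclic sum the terms mixing
p and q cancel by invariance, and the sum is exactly this difference. -/
theorem IsLagrangianProj.jacobi {κ : LinearMap.BilinForm ℝ V} {p q : V →ₗ[ℝ] V}
    (hsymm : ∀ a b, κ a b = κ b a) (hinv : ∀ a b c, κ ⁅a, b⁆ c = κ a ⁅b, c⁆)
    (hp : IsLagrangianProj κ p) (hq : IsLagrangianProj κ q) (a b c : V) :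
    (κ c ⁅p a - q a, p b - q b⁆ - (κ (q ⁅p a - q a, b⁆) c + κ (q b) ⁅p a - q a, c⁆)) +
    (κ a ⁅p b - q b, p c - q c⁆ - (κ (q ⁅p b - q b, c⁆) a + κ (q c) ⁅p b - q b, a⁆)) +
    (κ b ⁅p c - q c, p a - q a⁆ - (κ (q ⁅p c - q c, a⁆) b + κ (q a) ⁅p c - q c, b⁆)) = 0 := by
  have cyc : ∀ x y z : V, κ x ⁅y, z⁆ = κ y ⁅z, x⁆ := fun x y z => by rw [hsymm, hinv]
  have anti : ∀ x y z : V, κ x ⁅y, z⁆ = - κ x ⁅z, y⁆ := fun x y z => by rw [← lie_skew, map_neg]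
  have e1 : ∀ x y z : V, κ (q ⁅x, y⁆) z = κ x ⁅y, z⁆ - κ x ⁅y, q z⁆ := fun x y z => by
    rw [hq.adj, hinv, hinv]
  have e2 := hp.isotropic a b c
  have e3 := hp.isotropic' a b c
  have e4 := hq.isotropic a b c
  have e5 := hq.isotropic' a b c
  -- Puts every triple product into a common cyclic order, with q moved off brackets by its adjoint
  -- relation, so that only linear algebra remains.
  rw [cyc c, e1, cyc b, cyc (p c - q c), e1, e1, cyc (p b - q b), cyc c, cyc (p c - q c), cyc
    (p c - q c),
    anti (q b), cyc (q b) c, cyc c, anti (q c), cyc (q c) a, anti (q a), cyc (p b - q b) c (q a),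
      cyc c (q a)]
  simp only [map_sub, LinearMap.sub_apply, lie_sub, sub_lie] at e2 e3 e4 e5 ⊢
  linear_combination e2 + e3 - e4 - e5
end Lagrangian

/-! ### The splitting of the double into two isotropic subalgebras. -/

section Double

variable {𝔤 : Type*} [LieRing 𝔤] [LieAlgebra ℝ 𝔤] [FiniteDimensional ℝ 𝔤] (B : LieBialgebra 𝔤)

/-- The projection of `𝔡` onto `𝔤` along `𝔤*`. -/
def projG : B.Double →ₗ[ℝ] B.Double := B.inl ∘ₗ B.prg

theorem prg_inl (x : 𝔤) : B.prg (B.inl x) = x := rfl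
theorem prgs_inl (x : 𝔤) : B.prgs (B.inl x) = 0 := rfl
theorem prg_inr (x : B.DualAlg) : B.prg (B.inr x) = 0 := rfl
theorem prgs_inr (x : B.DualAlg) : B.prgs (B.inr x) = x := rfl

theorem projG_add_inr (a : B.Double) : projG B a + B.inr (B.prgs a) = a :=
  Prod.ext (add_zero (B.prg a)) (zero_add (B.prgs a))

theorem sub_projG (a : B.Double) : a - projG B a = B.inr (B.prgs a) :=
  sub_eq_of_eq_add' (projG_add_inr B a).symm

theorem pairing_symm (a b : B.Double) : B.pairing a b = B.pairing b a := by
  rw [B.pairing_apply, B.pairing_apply, add_comm]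

theorem pairing_inl_inl (x y : 𝔤) : B.pairing (B.inl x) (B.inl y) = 0 := by
  simp [B.pairing_apply, prgs_inl]

theorem pairing_inr_inr (x y : B.DualAlg) : B.pairing (B.inr x) (B.inr y) = 0 := by
  simp [B.pairing_apply, prg_inr]

theorem pairing_inr_right (a : B.Double) (y : B.DualAlg) :
    B.pairing a (B.inr y) = B.toDual y (B.prg a) := by
  simp [B.pairing_apply, prg_inr, prgs_inr]

theorem pairing_inl_right (a : B.Double) (y : 𝔤) :
    B.pairing a (B.inl y) = B.toDual (B.prgs a) y := by
  simp [B.pairing_apply, prg_inl, prgs_inl]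

theorem coad_zero_right (x : 𝔤) : B.coad x 0 = 0 := B.dual_ext fun u => by simp [B.coad_apply]

theorem coad_zero_left (x : B.DualAlg) : B.coad 0 x = 0 := B.dual_ext fun u => by
  simp [B.coad_apply]

theorem coadDual_zero_left (x : 𝔤) : B.coadDual 0 x = 0 := by simp [LieBialgebra.coadDual]

theorem coadDual_zero_right (x : B.DualAlg) : B.coadDual x 0 = 0 := by
  simp [LieBialgebra.coadDual]

theorem inl_lie (x y : 𝔤) : B.inl ⁅x, y⁆ = ⁅B.inl x, B.inl y⁆ := by
  apply B.double_ext <;> intro z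
  · simp [B.prg_lie, prg_inl, prgs_inl, coadDual_zero_left]
  · simp [B.prgs_lie, prg_inl, prgs_inl, coad_zero_right]

theorem inr_lie (x y : B.DualAlg) : B.inr ⁅x, y⁆ = ⁅B.inr x, B.inr y⁆ := by
  apply B.double_ext <;> intro z
  · simp [B.prg_lie, prg_inr, prgs_inr, coadDual_zero_right]
  · simp [B.prgs_lie, prg_inr, prgs_inr, coad_zero_left]

theorem isLagrangianProj_projG : IsLagrangianProj B.pairing (projG B) where
  adj a b := by
    have h : B.pairing a b - B.pairing a (projG B b) = B.pairing a (B.inr (B.prgs b)) := by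
      rw [← sub_projG, map_sub]
    rw [h, pairing_inr_right, projG, LinearMap.comp_apply, pairing_symm, pairing_inl_right]
  isotropic a b c := by
    simp only [projG, LinearMap.comp_apply, ← inl_lie, pairing_inl_inl]
  isotropic' a b c := by
    simp only [sub_projG, ← inr_lie, pairing_inr_inr]

end Double

/-! ### The adjoint action, translations and homomorphisms in terms of the abstract Lie algebras. -/

section Ident

variable {E : Type*} [NormedAddCommGroup E] [NormedSpace ℝ E]
  {G : Type*} [TopologicalSpace G] [ChartedSpace E G] [Group G]
  {𝔞 : Type*} [LieRing 𝔞] [LieAlgebra ℝ 𝔞] (e : LieAlgebraIdent E G 𝔞)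

/-- The identification of the Lie algebra with the model space. -/
def LieAlgebraIdent.toModel : 𝔞 ≃ₗ[ℝ] E := e.equiv

theorem LieAlgebraIdent.toModel_lie (a b : 𝔞) :
    e.toModel ⁅a, b⁆ = rbr E G (e.toModel a) (e.toModel b) := e.map_lie a b

theorem LieAlgebraIdent.toModel_Ad (g : G) (a : 𝔞) :
    e.toModel (e.Ad g a) = AdE E g (e.toModel a) := e.toModel.apply_symm_apply _

theorem LieAlgebraIdent.rightTriv_eq (g : G) (a : 𝔞) :
    rightTriv E g (e.equiv a) = rt E g (e.toModel a) := rfl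

theorem LieAlgebraIdent.leftTriv_eq (g : G) (a : 𝔞) :
    leftTriv E g (e.equiv a) = lt E g (e.toModel a) := rfl

variable [LieGroup 𝓘(ℝ, E) ∞ G]

theorem LieAlgebraIdent.Ad_one (a : 𝔞) : e.Ad (1 : G) a = a := by
  apply e.toModel.injective
  rw [e.toModel_Ad, AdE_one]; rfl

theorem LieAlgebraIdent.Ad_mul (g h : G) (a : 𝔞) : e.Ad (g * h) a = e.Ad g (e.Ad h a) := by
  apply e.toModel.injective
  rw [e.toModel_Ad, e.toModel_Ad, e.toModel_Ad, AdE_mul]; rfl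

theorem LieAlgebraIdent.Ad_Ad_inv (g : G) (a : 𝔞) : e.Ad g (e.Ad g⁻¹ a) = a := by
  rw [← e.Ad_mul, mul_inv_cancel, e.Ad_one]

theorem LieAlgebraIdent.Ad_lie [CompleteSpace E] (g : G) (a b : 𝔞) :
    e.Ad g ⁅a, b⁆ = ⁅e.Ad g a, e.Ad g b⁆ := by
  apply e.toModel.injective
  rw [e.toModel_Ad, e.toModel_lie, AdE_rbr, e.toModel_lie, e.toModel_Ad, e.toModel_Ad]

theorem LieAlgebraIdent.leftTriv_eq_rightTriv (g : G) (a : 𝔞) :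
    leftTriv E g (e.equiv a) = rightTriv E g (e.equiv (e.Ad g a)) := by
  rw [e.leftTriv_eq, e.rightTriv_eq, e.toModel_Ad, lt_eq]; rfl

theorem dLeft_rightTriv (g h : G) (a : 𝔞) :
    dLeft E g h (rightTriv E h (e.equiv a)) = rightTriv E (g * h) (e.equiv (e.Ad g a)) := by
  have h1 := mder_comp (E := E) (g := fun y : G => g * y) (f := fun y : G => y * h) (x := 1)
    (mdiff_mul_left (E := E) g _) (mdiff_mul_right (E := E) h _)
  have h2 := mder_comp (E := E) (g := fun y : G => y * (g * h)) (f := fun y : G => g * y * g⁻¹)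
    (x := 1)
    (mdiff_mul_right (E := E) (g * h) _) (mdiff_conj (E := E) g _)
  have h3 : (fun y : G => g * (y * h)) = fun y => g * y * g⁻¹ * (g * h) := by
    ext y; group
  rw [h3, h2] at h1
  simp only [mul_one, mul_inv_cancel, one_mul] at h1
  have h4 := congrArg (fun T : E →L[ℝ] E => T (e.toModel a)) h1
  rw [e.rightTriv_eq (g * h), e.toModel_Ad]
  exact h4.symm

theorem dRight_rightTriv (g h : G) (u : GroupLieAlgebra 𝓘(ℝ, E) G) :
    dRight E h g (rightTriv E g u) = rightTriv E (g * h) u :=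
  (congrArg (fun T : E →L[ℝ] E => T u) (rt_mul (E := E) g h)).symm

theorem rightTrivInv_rightTriv (g : G) (u : GroupLieAlgebra 𝓘(ℝ, E) G) :
    rightTrivInv E g (rightTriv E g u) = u := by
  have h := congrArg (fun T : E →L[ℝ] E => T u) (rt_mul (E := E) g g⁻¹)
  rw [mul_inv_cancel, rt_one] at h
  exact h.symm

variable {E' : Type*} [NormedAddCommGroup E'] [NormedSpace ℝ E']
  {D : Type*} [TopologicalSpace D] [ChartedSpace E' D] [Group D] [LieGroup 𝓘(ℝ, E') ∞ D]
  {𝔟 : Type*} [LieRing 𝔟] [LieAlgebra ℝ 𝔟] {e} {e' : LieAlgebraIdent E' D 𝔟} {ι : 𝔞 →ₗ[ℝ] 𝔟}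
  {ψ : G →* D}

theorem IsIntegration.mdiff (h : IsIntegration e e' ι ψ) (g : G) :
    MDifferentiableAt 𝓘(ℝ, E) 𝓘(ℝ, E') ψ g := h.smooth.mdifferentiableAt (by simp)

theorem IsIntegration.mder_one (h : IsIntegration e e' ι ψ) (a : 𝔞) :
    mder E E' ψ 1 (e.toModel a) = e'.toModel (ι a) := h.deriv a

theorem IsIntegration.mder_rt (h : IsIntegration e e' ι ψ) (g : G) (a : 𝔞) :
    mder E E' ψ g (rt E g (e.toModel a)) = rt E' (ψ g) (e'.toModel (ι a)) := by
  have h1 := mder_comp (E := E) (g := ψ) (f := fun y : G => y * g) (x := 1)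
    (h.mdiff _) (mdiff_mul_right (E := E) g _)
  have h2 := mder_comp (E := E) (g := fun z : D => z * ψ g) (f := ψ) (x := 1)
    (mdiff_mul_right (E := E') (ψ g) _) (h.mdiff _)
  simp only [map_mul] at h1
  rw [h2, one_mul] at h1
  have h3 := congrArg (fun T : E →L[ℝ] E' => T (e.toModel a)) h1
  simp only [ContinuousLinearMap.comp_apply, map_one, h.mder_one] at h3
  exact h3.symm

theorem IsIntegration.dmap_rightTriv (h : IsIntegration e e' ι ψ) (g : G) (a : 𝔞) :
    dmap E E' ψ g (rightTriv E g (e.equiv a)) = rightTriv E' (ψ g) (e'.equiv (ι a)) :=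
  h.mder_rt g a

theorem IsIntegration.map_Ad (h : IsIntegration e e' ι ψ) (g : G) (a : 𝔞) :
    ι (e.Ad g a) = e'.Ad (ψ g) (ι a) := by
  apply e'.toModel.injective
  rw [← h.mder_one, e'.toModel_Ad, e.toModel_Ad, ← h.mder_one]
  have h1 := mder_comp (E := E) (g := ψ) (f := fun y : G => g * y * g⁻¹) (x := 1)
    (h.mdiff _) (mdiff_conj (E := E) g _)
  have h2 := mder_comp (E := E) (g := fun z : D => ψ g * z * (ψ g)⁻¹) (f := ψ) (x := 1)
    (mdiff_conj (E := E') (ψ g) _) (h.mdiff _)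
  simp only [map_mul, map_inv] at h1
  rw [h2] at h1
  have h3 := congrArg (fun T : E →L[ℝ] E' => T (e.toModel a)) h1
  simp only [ContinuousLinearMap.comp_apply, map_one, mul_one, mul_inv_cancel] at h3
  exact h3.symm

theorem IsIntegration.rd_comp (h : IsIntegration e e' ι ψ) {F : Type*} [NormedAddCommGroup F]
    [NormedSpace ℝ F] {f : D → F} {g : G} (hf : MDifferentiableAt 𝓘(ℝ, E') 𝓘(ℝ, F) f (ψ g)) (a : 𝔞) :
    rd E (fun y => f (ψ y)) (e.toModel a) g = rd E' f (e'.toModel (ι a)) (ψ g) := by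
  rw [rd, mder_comp hf (h.mdiff g), ContinuousLinearMap.comp_apply, h.mder_rt, rd]

theorem IsIntegration.id (e : LieAlgebraIdent E G 𝔞) :
    IsIntegration e e LinearMap.id (MonoidHom.id G) where
  smooth := contMDiff_id
  deriv a := congrArg (fun T : E →L[ℝ] E => T (e.toModel a)) (mder_id (E := E) (1 : G))

end Ident

/-! ### Calculus with bilinear forms and finite sums. -/

section Bilinear
variable {E : Type*} [NormedAddCommGroup E] [NormedSpace ℝ E]
  {M : Type*} [TopologicalSpace M] [ChartedSpace E M] [IsManifold 𝓘(ℝ, E) ∞ M]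
  {F : Type*} [NormedAddCommGroup F] [NormedSpace ℝ F] [FiniteDimensional ℝ F]

/-- A bilinear form on a finite dimensional space, as a continuous bilinear map. -/
def toCLM₂ (b : LinearMap.BilinForm ℝ F) : F →L[ℝ] F →L[ℝ] ℝ :=
  LinearMap.toContinuousLinearMap (LinearMap.toContinuousLinearMap.toLinearMap ∘ₗ b)

theorem contMDiffAt_bilin (b : LinearMap.BilinForm ℝ F) {f g : M → F} {x : M}
    (hf : ContMDiffAt 𝓘(ℝ, E) 𝓘(ℝ, F) ∞ f x) (hg : ContMDiffAt 𝓘(ℝ, E) 𝓘(ℝ, F) ∞ g x) :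
    ContMDiffAt 𝓘(ℝ, E) 𝓘(ℝ, ℝ) ∞ (fun y => b (f y) (g y)) x :=
  ((toCLM₂ b).contDiff.contMDiff.contMDiffAt.comp x hf).clm_apply hg

theorem mder_bilin (b : LinearMap.BilinForm ℝ F) {f g : M → F} {x : M}
    (hf : MDifferentiableAt 𝓘(ℝ, E) 𝓘(ℝ, F) f x) (hg : MDifferentiableAt 𝓘(ℝ, E) 𝓘(ℝ, F) g x)
      (w : E) :
    mder E ℝ (fun y => b (f y) (g y)) x w = b (mder E F f x w) (g x) + b (f x) (mder E F g x w) := by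
  have hL : MDifferentiableAt 𝓘(ℝ, E) 𝓘(ℝ, F →L[ℝ] ℝ) (fun y => toCLM₂ b (f y)) x :=
    (toCLM₂ b).differentiableAt.mdifferentiableAt.comp x hf
  have h := mder_clm_apply hL hg w
  rw [mder_comp (g := toCLM₂ b) (toCLM₂ b).differentiableAt.mdifferentiableAt hf, mder_eq_fderiv,
    ContinuousLinearMap.fderiv] at h
  exact h

theorem mdifferentiableAt_fun_mul {f g : M → ℝ} {x : M}
    (hf : MDifferentiableAt 𝓘(ℝ, E) 𝓘(ℝ, ℝ) f x) (hg : MDifferentiableAt 𝓘(ℝ, E) 𝓘(ℝ, ℝ) g x) :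
    MDifferentiableAt 𝓘(ℝ, E) 𝓘(ℝ, ℝ) (fun y => f y * g y) x := hf.mul hg

theorem mdifferentiableAt_fun_sum {κ : Type*} (s : Finset κ) {f : κ → M → ℝ} {x : M}
    (hf : ∀ k ∈ s, MDifferentiableAt 𝓘(ℝ, E) 𝓘(ℝ, ℝ) (f k) x) :
    MDifferentiableAt 𝓘(ℝ, E) 𝓘(ℝ, ℝ) (fun y => ∑ k ∈ s, f k y) x := by
  classical
  induction s using Finset.induction_on with
  | empty => simpa using mdifferentiableAt_const
  | insert k s hk ih =>
    simp only [Finset.sum_insert hk]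
    exact (hf k (Finset.mem_insert_self k s)).add
      (ih fun j hj => hf j (Finset.mem_insert_of_mem hj))

theorem mder_sum {κ : Type*} (s : Finset κ) {f : κ → M → ℝ} {x : M}
    (hf : ∀ k ∈ s, MDifferentiableAt 𝓘(ℝ, E) 𝓘(ℝ, ℝ) (f k) x) (w : E) :
    mder E ℝ (fun y => ∑ k ∈ s, f k y) x w = ∑ k ∈ s, mder E ℝ (f k) x w := by
  have h := HasFDerivAt.fun_sum fun k hk => hasFDerivAt_comp_extChartAt_symm (hf k hk)
  rw [mder_eq_of_hasFDerivAt (mdifferentiableAt_fun_sum s hf) h]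
  simp

theorem mder_mul {f g : M → ℝ} {x : M}
    (hf : MDifferentiableAt 𝓘(ℝ, E) 𝓘(ℝ, ℝ) f x) (hg : MDifferentiableAt 𝓘(ℝ, E) 𝓘(ℝ, ℝ) g x)
      (w : E) :
    mder E ℝ (fun y => f y * g y) x w = mder E ℝ f x w * g x + f x * mder E ℝ g x w :=
  mder_bilin (LinearMap.mul ℝ ℝ) hf hg w

end Bilinear
-- The skew operator p - Ad_d p Ad_d⁻¹ on the double.
section S

variable {𝔤 : Type*} [LieRing 𝔤] [LieAlgebra ℝ 𝔤] [FiniteDimensional ℝ 𝔤] {B : LieBialgebra 𝔤}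
  {ED : Type*} [NormedAddCommGroup ED] [NormedSpace ℝ ED] [FiniteDimensional ℝ ED]
  {D : Type*} [TopologicalSpace D] [ChartedSpace ED D] [Group D] [LieGroup 𝓘(ℝ, ED) ∞ D]
  (eD : QuadraticIdent B ED D)

/-- The projection of `𝔡` onto `Ad_d 𝔤` along `Ad_d 𝔤*`. -/
def projAd (d : D) : B.Double →ₗ[ℝ] B.Double := eD.Ad d ∘ₗ projG B ∘ₗ eD.Ad d⁻¹

theorem projAd_apply (d : D) (a : B.Double) :
    projAd eD d a = eD.Ad d (projG B (eD.Ad d⁻¹ a)) := rfl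

/-- The skew-symmetric operator `p - Ad_d p Ad_d⁻¹` on `𝔡`, where `p` is the projection of `𝔡`
onto `𝔤` along `𝔤*`. -/
def skewOp (d : D) : B.Double →ₗ[ℝ] B.Double := projG B - projAd eD d

theorem skewOp_apply (d : D) (a : B.Double) : skewOp eD d a = projG B a - projAd eD d a := rfl

theorem pairing_Ad_left (d : D) (a b : B.Double) :
    B.pairing (eD.Ad d a) b = B.pairing a (eD.Ad d⁻¹ b) := by
  rw [← eD.pairing_Ad d a, eD.Ad_Ad_inv]

theorem pairing_Ad_right (d : D) (a b : B.Double) :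
    B.pairing a (eD.Ad d b) = B.pairing (eD.Ad d⁻¹ a) b := by
  rw [← eD.pairing_Ad d _ b, eD.Ad_Ad_inv]

theorem isLagrangianProj_projAd (d : D) : IsLagrangianProj B.pairing (projAd eD d) :=
  (isLagrangianProj_projG B).conj (eD.pairing_Ad d) (eD.Ad_lie d) (eD.Ad_Ad_inv d)

/-- The adjoint of each of the two projections is its complementary projection, so the identities
cancel in the difference. -/
theorem pairing_skewOp (d : D) (a b : B.Double) :
    B.pairing (skewOp eD d a) b = - B.pairing a (skewOp eD d b) := by
  simp only [skewOp_apply, map_sub, LinearMap.sub_apply, (isLagrangianProj_projG B).adj,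
    (isLagrangianProj_projAd eD d).adj]
  ring

theorem pairing_skewOp_self (d : D) (a : B.Double) : B.pairing (skewOp eD d a) a = 0 := by
  have h := pairing_skewOp eD d a a
  rw [pairing_symm B a] at h
  linarith

theorem projAd_one (a : B.Double) : projAd eD 1 a = projG B a := by
  rw [projAd_apply, inv_one, eD.Ad_one, eD.Ad_one]

/-- As a function of d the operator is a coboundary for conjugation by Ad, so the middle terms
telescope. This cocycle identity is the source of multiplicativity. -/
theorem skewOp_mul (g h : D) (a : B.Double) :
    skewOp eD (g * h) a = skewOp eD g a + eD.Ad g (skewOp eD h (eD.Ad g⁻¹ a)) := by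
  simp only [skewOp_apply, projAd_apply, mul_inv_rev, eD.Ad_mul, map_sub]
  abel

/-- The bilinear form `(x, y) ↦ ⟨p x, y⟩` on the model space of `D`. -/
def projForm : LinearMap.BilinForm ℝ ED :=
  B.pairing.compl₁₂ (projG B ∘ₗ eD.toModel.symm.toLinearMap) eD.toModel.symm.toLinearMap

/-- By invariance of the pairing, d enters only through Ad_{d⁻¹} a and Ad_{d⁻¹} b inside a fixed
bilinear form, so smoothness and derivatives follow from those of the adjoint action. -/
theorem pairing_projAd (d : D) (a b : B.Double) : B.pairing (projAd eD d a) b =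
    projForm eD (AdE ED d⁻¹ (eD.toModel a)) (AdE ED d⁻¹ (eD.toModel b)) := by
  rw [← eD.toModel_Ad, ← eD.toModel_Ad, projAd_apply, pairing_Ad_left]
  simp [projForm]

theorem pairing_skewOp_eq (a b : B.Double) : (fun d : D => B.pairing (skewOp eD d a) b) = fun d =>
    B.pairing (projG B a) b -
      projForm eD (AdE ED d⁻¹ (eD.toModel a)) (AdE ED d⁻¹ (eD.toModel b)) := by
  ext d
  rw [← pairing_projAd, skewOp_apply, map_sub, LinearMap.sub_apply]

theorem contMDiff_pairing_skewOp (a b : B.Double) :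
    ContMDiff 𝓘(ℝ, ED) 𝓘(ℝ, ℝ) ∞ (fun d : D => B.pairing (skewOp eD d a) b) := by
  rw [pairing_skewOp_eq]
  intro d
  exact contMDiffAt_const.sub (contMDiffAt_bilin _ (contMDiff_AdE_inv _ d) (contMDiff_AdE_inv _ d))

theorem rd_pairing_skewOp (a b x : B.Double) (d : D) :
    rd ED (fun d : D => B.pairing (skewOp eD d a) b) (eD.toModel x) d =
      -(B.pairing (projAd eD d ⁅x, a⁆) b + B.pairing (projAd eD d a) ⁅x, b⁆) := by
  have h1 : ∀ c, MDifferentiableAt 𝓘(ℝ, ED) 𝓘(ℝ, ED) (fun y : D => AdE ED y⁻¹ c) d := fun c =>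
    (contMDiff_AdE_inv c).mdifferentiableAt (by simp)
  have h2 := mder_bilin (projForm eD) (h1 (eD.toModel a)) (h1 (eD.toModel b))
    (rt ED d (eD.toModel x))
  have h3 : MDifferentiableAt 𝓘(ℝ, ED) 𝓘(ℝ, ℝ) (fun d : D =>
      projForm eD (AdE ED d⁻¹ (eD.toModel a)) (AdE ED d⁻¹ (eD.toModel b))) d :=
    (contMDiffAt_bilin _ (contMDiff_AdE_inv _ d) (contMDiff_AdE_inv _ d)).mdifferentiableAt
      (by simp)
  have h4 : ∀ c, mder ED ED (fun y : D => AdE ED y⁻¹ (eD.toModel c)) d (rt ED d (eD.toModel x)) =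
      AdE ED d⁻¹ (eD.toModel ⁅x, c⁆) := fun c => by
    rw [eD.toModel_lie]; exact mder_AdE_inv d _ _
  rw [h4, h4, ← pairing_projAd, ← pairing_projAd] at h2
  rw [rd, pairing_skewOp_eq, ← h2]
  have h5 := (hasFDerivAt_comp_extChartAt_symm h3).const_sub (B.pairing (projG B a) b)
  have h6 : MDifferentiableAt 𝓘(ℝ, ED) 𝓘(ℝ, ℝ) (fun d : D => B.pairing (projG B a) b -
      projForm eD (AdE ED d⁻¹ (eD.toModel a)) (AdE ED d⁻¹ (eD.toModel b))) d :=
    mdifferentiableAt_const.sub h3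
  rw [mder_eq_of_hasFDerivAt h6 h5]
  rfl
end S

/-! ### Bivector fields induced by the skew operator along a homomorphism into D. -/

section Induced
variable {𝔤 : Type*} [LieRing 𝔤] [LieAlgebra ℝ 𝔤] [FiniteDimensional ℝ 𝔤] {B : LieBialgebra 𝔤}
  {ED : Type*} [NormedAddCommGroup ED] [NormedSpace ℝ ED] [FiniteDimensional ℝ ED]
  {D : Type*} [TopologicalSpace D] [ChartedSpace ED D] [Group D] [LieGroup 𝓘(ℝ, ED) ∞ D]
  {E : Type*} [NormedAddCommGroup E] [NormedSpace ℝ E] [FiniteDimensional ℝ E]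
  {G : Type*} [TopologicalSpace G] [ChartedSpace E G] [Group G] [LieGroup 𝓘(ℝ, E) ∞ G]
  {𝔞 : Type*} [LieRing 𝔞] [LieAlgebra ℝ 𝔞]

/-- `a ∈ 𝔡` represents the covector `α` at `g`: the functional `⟨a, ι ·⟩` is the value of `α`
on right invariant vector fields. -/
def Represents (e : LieAlgebraIdent E G 𝔞) (ι : 𝔞 →ₗ[ℝ] B.Double) (g : G)
    (α : Module.Dual ℝ (TangentSpace 𝓘(ℝ, E) g)) (a : B.Double) : Prop :=
  ∀ x, B.pairing a (ι x) = α (rightTriv E g (e.equiv x))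

/-- The bivector field `π` on `G` is given by `π(α, β) = ε ⟨(p - Ad_ψ(g) p Ad_ψ(g)⁻¹) a, b⟩`, where
`a, b ∈ 𝔡` represent the covectors `α, β` at `g`, `ψ : G → D` is a homomorphism with differential
the Lie algebra map `ι`, and `ε = ±1`. -/
structure IsInduced (eD : QuadraticIdent B ED D) (e : LieAlgebraIdent E G 𝔞)
    (ι : 𝔞 →ₗ[ℝ] B.Double) (ψ : G →* D) (ε : ℝ) (π : TensorField E G) : Prop where
  integration : IsIntegration e eD.toLieAlgebraIdent ι ψ
  map_lie : ∀ x y, ι ⁅x, y⁆ = ⁅ι x, ι y⁆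
  exists_lift : ∀ ξ : Module.Dual ℝ 𝔞, ∃ a, ∀ x, B.pairing a (ι x) = ξ x
  skewOp_mem : ∀ g a, ∃ x, ι x = skewOp eD (ψ g) a
  sq : ε * ε = 1
  apply : ∀ g α β a b, Represents e ι g α a → Represents e ι g β b →
    π g α β = ε * B.pairing (skewOp eD (ψ g) a) b

namespace IsInduced
variable {eD : QuadraticIdent B ED D} {e : LieAlgebraIdent E G 𝔞} {ι : 𝔞 →ₗ[ℝ] B.Double}
  {ψ : G →* D} {ε : ℝ} {π : TensorField E G}

theorem exists_represents (h : IsInduced eD e ι ψ ε π) (g : G)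
    (α : Module.Dual ℝ (TangentSpace 𝓘(ℝ, E) g)) : ∃ a, Represents e ι g α a :=
  h.exists_lift (α ∘ₗ rightTriv E g ∘ₗ e.equiv.toLinearMap)

theorem alt (h : IsInduced eD e ι ψ ε π) (g : G) (α : Module.Dual ℝ (TangentSpace 𝓘(ℝ, E) g)) :
    π g α α = 0 := by
  obtain ⟨a, ha⟩ := h.exists_represents g α
  rw [h.apply g α α a a ha ha, pairing_skewOp_self, mul_zero]

/-- Pulling a covector back by right translation keeps its representative a, and by left translation
by g replaces it with Ad_{ψ(g)⁻¹} a. The claim becomes the cocycle identity for `skewOp`. -/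
theorem isMultiplicative (h : IsInduced eD e ι ψ ε π) : IsMultiplicative π := by
  intro g k α β
  have hl : ∀ (α : Module.Dual ℝ (TangentSpace 𝓘(ℝ, E) (g * k))) (a : B.Double),
      Represents e ι (g * k) α a →
      Represents e ι k (α ∘ₗ dLeft E g k) (eD.Ad (ψ g)⁻¹ a) := fun α a ha x => by
    rw [LinearMap.comp_apply, dLeft_rightTriv, ← ha, h.integration.map_Ad, pairing_Ad_right]
  have hr : ∀ (α : Module.Dual ℝ (TangentSpace 𝓘(ℝ, E) (g * k))) (a : B.Double),
      Represents e ι (g * k) α a →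
      Represents e ι g (α ∘ₗ dRight E k g) a := fun α a ha x => by
    rw [LinearMap.comp_apply, dRight_rightTriv, ← ha]
  obtain ⟨a, ha⟩ := h.exists_represents _ α
  obtain ⟨b, hb⟩ := h.exists_represents _ β
  rw [h.apply _ _ _ _ _ ha hb, h.apply _ _ _ _ _ (hl α a ha) (hl β b hb),
    h.apply _ _ _ _ _ (hr α a ha) (hr β b hb), map_mul, skewOp_mul, map_add, LinearMap.add_apply,
    pairing_Ad_left]
  ring

theorem contMDiff_pairing (h : IsInduced eD e ι ψ ε π) (a b : B.Double) :
    ContMDiff 𝓘(ℝ, E) 𝓘(ℝ, ℝ) ∞ (fun g : G => B.pairing (skewOp eD (ψ g) a) b) :=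
  (contMDiff_pairing_skewOp eD a b).comp h.integration.smooth

theorem rd_pairing (h : IsInduced eD e ι ψ ε π) (a b : B.Double) (x : 𝔞) (g : G) :
    rd E (fun g : G => B.pairing (skewOp eD (ψ g) a) b) (e.toModel x) g =
      -(B.pairing (projAd eD (ψ g) ⁅ι x, a⁆) b + B.pairing (projAd eD (ψ g) a) ⁅ι x, b⁆) := by
  rw [← rd_pairing_skewOp]
  exact h.integration.rd_comp ((contMDiff_pairing_skewOp eD a b).mdifferentiableAt (by simp)) x

/-- A representative of α on D represents the pullback of α along ψ as well, so both sides are the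
same expression in the same a and b. -/
theorem map_apply {ϖ : TensorField ED D} (h : IsInduced eD e ι ψ ε π)
    (h' : IsInduced eD eD.toLieAlgebraIdent LinearMap.id (MonoidHom.id D) ε ϖ) (g : G)
    (α β : Module.Dual ℝ (TangentSpace 𝓘(ℝ, ED) (ψ g))) :
    ϖ (ψ g) α β = π g (α ∘ₗ dmap E ED ψ g) (β ∘ₗ dmap E ED ψ g) := by
  have hl : ∀ (α : Module.Dual ℝ (TangentSpace 𝓘(ℝ, ED) (ψ g))) (a : B.Double),
      Represents eD.toLieAlgebraIdent LinearMap.id (ψ g) α a →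
      Represents e ι g (α ∘ₗ dmap E ED ψ g) a := fun α a ha x => by
    rw [LinearMap.comp_apply, h.integration.dmap_rightTriv, ← ha]; rfl
  obtain ⟨a, ha⟩ := h'.exists_represents _ α
  obtain ⟨b, hb⟩ := h'.exists_represents _ β
  rw [h'.apply _ _ _ _ _ ha hb, h.apply _ _ _ _ _ (hl α a ha) (hl β b hb)]
  rfl

/-- With representatives fixed, the right trivialized field is ε⟨(p - q) a, b⟩ as a function of the
group element. Its derivative at the identity, where q = p, is the expression required of the
cobracket. The choice of representatives is left free so that they can be taken in one isotropic
summand. -/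
theorem hasLieBialgebra (h : IsInduced eD e ι ψ ε π) (B' : LieBialgebra 𝔞)
    (hB : ∀ (x : 𝔞) (ξ η : Module.Dual ℝ 𝔞), ∃ a b : B.Double,
      (∀ x, B.pairing a (ι x) = ξ x) ∧ (∀ x, B.pairing b (ι x) = η x) ∧ B'.cobracket x ξ η =
      -ε * (B.pairing (projG B ⁅ι x, a⁆) b + B.pairing (projG B a) ⁅ι x, b⁆)) :
    HasLieBialgebra e π B' := by
  intro α β
  have key : ∀ a b : B.Double, (∀ x, B.pairing a (ι x) = α (e.equiv x)) →
      (∀ x, B.pairing b (ι x) = β (e.equiv x)) →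
      rightTrivialized π α β = fun g => ε * B.pairing (skewOp eD (ψ g) a) b := by
    intro a b ha hb
    ext g
    refine h.apply _ _ _ _ _ (fun x => ?_) (fun x => ?_)
    · rw [ha, LinearMap.comp_apply, rightTrivInv_rightTriv]
    · rw [hb, LinearMap.comp_apply, rightTrivInv_rightTriv]
  have hd : ∀ a b : B.Double, MDifferentiableAt 𝓘(ℝ, E) 𝓘(ℝ, ℝ)
      (fun g : G => B.pairing (skewOp eD (ψ g) a) b) 1 := fun a b =>
    (h.contMDiff_pairing a b).mdifferentiableAt (by simp)
  constructor
  · obtain ⟨a, ha⟩ := h.exists_lift (α ∘ₗ e.equiv.toLinearMap)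
    obtain ⟨b, hb⟩ := h.exists_lift (β ∘ₗ e.equiv.toLinearMap)
    rw [key a b ha hb]
    exact mdifferentiableAt_const.mul (hd a b)
  · intro u
    obtain ⟨a, b, ha, hb, hab⟩ := hB u (α ∘ₗ e.equiv.toLinearMap) (β ∘ₗ e.equiv.toLinearMap)
    rw [key a b ha hb, hab]
    have h1 : mder E ℝ (fun g : G => ε * B.pairing (skewOp eD (ψ g) a) b) 1 (e.toModel u) =
        ε * rd E (fun g : G => B.pairing (skewOp eD (ψ g) a) b) (e.toModel u) 1 := by
      rw [mder_mul mdifferentiableAt_const (hd a b), mder_const, rd, rt_one]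
      simp
    refine Eq.trans h1 ?_
    rw [h.rd_pairing, map_one, projAd_one, projAd_one]
    ring

/-! ### Gradients in the double and the Jacobi identity. -/

section Gradient

variable {κ : Type*} [Fintype κ] (e) (bs : Module.Basis κ ℝ 𝔞) (l : κ → B.Double)

/-- The element of `𝔡` representing `df`, in terms of representatives `l` of the dual basis. -/
def grad (f : G → ℝ) (g : G) : B.Double := ∑ k, rd E f (e.toModel (bs k)) g • l k

/-- The derivative of `grad f` along a right invariant vector field. -/
def gradDeriv (f : G → ℝ) (x : 𝔞) (g : G) : B.Double :=
  ∑ k, rd E (rd E f (e.toModel (bs k))) (e.toModel x) g • l k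

theorem rd_eq_sum (f : G → ℝ) (x : 𝔞) (g : G) :
    rd E f (e.toModel x) g = ∑ k, rd E f (e.toModel (bs k)) g * bs.coord k x := by
  conv_lhs => rw [← bs.sum_repr x]
  simp only [rd, map_sum, map_smul, smul_eq_mul, Module.Basis.coord_apply, mul_comm]

variable {bs l}

theorem pairing_grad (hl : ∀ k x, B.pairing (l k) (ι x) = bs.coord k x) (f : G → ℝ) (g : G)
    (x : 𝔞) : B.pairing (grad e bs l f g) (ι x) = rd E f (e.toModel x) g := by
  rw [rd_eq_sum e bs]
  simp only [grad, map_sum, map_smul, LinearMap.sum_apply, LinearMap.smul_apply, smul_eq_mul, hl]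

theorem pairing_gradDeriv (hl : ∀ k x, B.pairing (l k) (ι x) = bs.coord k x) {f : G → ℝ} {g : G}
    (hf : SmoothAt E f g) (x z : 𝔞) : B.pairing (gradDeriv e bs l f x g) (ι z) =
      rd E (rd E f (e.toModel z)) (e.toModel x) g := by
  have h1 : rd E f (e.toModel z) = fun y => ∑ k, rd E f (e.toModel (bs k)) y * bs.coord k z :=
    funext fun y => rd_eq_sum e bs f z y
  have h2 : ∀ k, MDifferentiableAt 𝓘(ℝ, E) 𝓘(ℝ, ℝ) (rd E f (e.toModel (bs k))) g := fun k =>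
    (contMDiffAt_rd hf _).mdifferentiableAt (by simp)
  rw [h1]
  conv_rhs => rw [rd]
  rw [mder_sum _ fun k _ => mdifferentiableAt_fun_mul (h2 k) mdifferentiableAt_const]
  simp only [gradDeriv, map_sum, map_smul, LinearMap.sum_apply, LinearMap.smul_apply, smul_eq_mul,
    hl, mder_mul (h2 _) mdifferentiableAt_const, mder_const]
  simp [rd]

theorem represents_grad (hl : ∀ k x, B.pairing (l k) (ι x) = bs.coord k x) (f : G → ℝ) (g : G) :
    Represents e ι g (dfun E f g) (grad e bs l f g) := fun x => pairing_grad e hl f g x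

variable {e}

theorem poissonBracket_eq (h : IsInduced eD e ι ψ ε π)
    (hl : ∀ k x, B.pairing (l k) (ι x) = bs.coord k x) (f₁ f₂ : G → ℝ) (g : G) :
    poissonBracket π f₁ f₂ g =
      ε * B.pairing (skewOp eD (ψ g) (grad e bs l f₁ g)) (grad e bs l f₂ g) :=
  h.apply _ _ _ _ _ (represents_grad e hl f₁ g) (represents_grad e hl f₂ g)

theorem poissonBracket_eq_sum (h : IsInduced eD e ι ψ ε π)
    (hl : ∀ k x, B.pairing (l k) (ι x) = bs.coord k x) (f₁ f₂ : G → ℝ) :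
    poissonBracket π f₁ f₂ = fun g => ∑ k, ∑ j, rd E f₁ (e.toModel (bs k)) g *
      (rd E f₂ (e.toModel (bs j)) g * (ε * B.pairing (skewOp eD (ψ g) (l k)) (l j))) := by
  ext g
  rw [h.poissonBracket_eq hl]
  simp only [grad, map_sum, map_smul, LinearMap.sum_apply, LinearMap.smul_apply, smul_eq_mul,
    Finset.mul_sum]
  rw [Finset.sum_comm]
  refine Finset.sum_congr rfl fun k _ => Finset.sum_congr rfl fun j _ => by ring

theorem contMDiffAt_poissonBracket (h : IsInduced eD e ι ψ ε π)
    (hl : ∀ k x, B.pairing (l k) (ι x) = bs.coord k x) {f₁ f₂ : G → ℝ} {g : G}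
    (h₁ : SmoothAt E f₁ g) (h₂ : SmoothAt E f₂ g) : SmoothAt E (poissonBracket π f₁ f₂) g := by
  rw [h.poissonBracket_eq_sum hl]
  refine contMDiffAt_finsetSum fun k _ => contMDiffAt_finsetSum fun j _ => ?_
  exact (contMDiffAt_rd h₁ _).mul ((contMDiffAt_rd h₂ _).mul
    (contMDiffAt_const.mul (h.contMDiff_pairing _ _ g)))

/-- Product rule: differentiating the coefficients of the two gradients gives the `gradDeriv` terms,
and differentiating the skew operator gives the terms in q. -/
theorem rd_poissonBracket (h : IsInduced eD e ι ψ ε π)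
    (hl : ∀ k x, B.pairing (l k) (ι x) = bs.coord k x) {f₁ f₂ : G → ℝ} {g : G}
    (h₁ : SmoothAt E f₁ g) (h₂ : SmoothAt E f₂ g) (x : 𝔞) :
    rd E (poissonBracket π f₁ f₂) (e.toModel x) g = ε *
      (B.pairing (skewOp eD (ψ g) (gradDeriv e bs l f₁ x g)) (grad e bs l f₂ g) +
       B.pairing (skewOp eD (ψ g) (grad e bs l f₁ g)) (gradDeriv e bs l f₂ x g) -
       (B.pairing (projAd eD (ψ g) ⁅ι x, grad e bs l f₁ g⁆) (grad e bs l f₂ g) +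
        B.pairing (projAd eD (ψ g) (grad e bs l f₁ g)) ⁅ι x, grad e bs l f₂ g⁆)) := by
  have d₁ : ∀ k, MDifferentiableAt 𝓘(ℝ, E) 𝓘(ℝ, ℝ) (rd E f₁ (e.toModel (bs k))) g := fun k =>
    (contMDiffAt_rd h₁ _).mdifferentiableAt (by simp)
  have d₂ : ∀ k, MDifferentiableAt 𝓘(ℝ, E) 𝓘(ℝ, ℝ) (rd E f₂ (e.toModel (bs k))) g := fun k =>
    (contMDiffAt_rd h₂ _).mdifferentiableAt (by simp)
  have d₃ : ∀ a b, MDifferentiableAt 𝓘(ℝ, E) 𝓘(ℝ, ℝ)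
      (fun g => B.pairing (skewOp eD (ψ g) a) b) g := fun a b =>
    (h.contMDiff_pairing a b).mdifferentiableAt (by simp)
  have d₄ : ∀ a b, MDifferentiableAt 𝓘(ℝ, E) 𝓘(ℝ, ℝ)
      (fun g => ε * B.pairing (skewOp eD (ψ g) a) b) g := fun a b =>
    mdifferentiableAt_const.mul (d₃ a b)
  have e₃ : ∀ a b, mder E ℝ (fun g => B.pairing (skewOp eD (ψ g) a) b) g
      (rt E g (e.toModel x)) = _ := fun a b => h.rd_pairing a b x g
  have e₄ : ∀ k u, mder E ℝ (rd E f₁ (e.toModel (bs k))) g (rt E g u) =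
    rd E (rd E f₁ (e.toModel (bs k))) u g := fun _ _ => rfl
  have e₅ : ∀ k u, mder E ℝ (rd E f₂ (e.toModel (bs k))) g (rt E g u) =
    rd E (rd E f₂ (e.toModel (bs k))) u g := fun _ _ => rfl
  rw [h.poissonBracket_eq_sum hl]
  conv_lhs => rw [rd]
  have hs : ∀ k j, MDifferentiableAt 𝓘(ℝ, E) 𝓘(ℝ, ℝ) (fun g => rd E f₁ (e.toModel (bs k)) g *
      (rd E f₂ (e.toModel (bs j)) g * (ε * B.pairing (skewOp eD (ψ g) (l k)) (l j)))) g :=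
    fun k j => (d₁ k).mul ((d₂ j).mul (d₄ _ _))
  rw [mder_sum _ fun k _ => mdifferentiableAt_fun_sum _ fun j _ => hs k j]
  have : ∀ k, mder E ℝ (fun g => ∑ j, rd E f₁ (e.toModel (bs k)) g *
      (rd E f₂ (e.toModel (bs j)) g * (ε * B.pairing (skewOp eD (ψ g) (l k)) (l j)))) g
      (rt E g (e.toModel x)) = ∑ j, mder E ℝ (fun g => rd E f₁ (e.toModel (bs k)) g *
      (rd E f₂ (e.toModel (bs j)) g * (ε * B.pairing (skewOp eD (ψ g) (l k)) (l j)))) g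
      (rt E g (e.toModel x)) := fun k => mder_sum _ (fun j _ => hs k j) _
  simp only [this]
  have h6 : ∀ k j, mder E ℝ (fun g => rd E f₁ (e.toModel (bs k)) g *
      (rd E f₂ (e.toModel (bs j)) g * (ε * B.pairing (skewOp eD (ψ g) (l k)) (l j)))) g
      (rt E g (e.toModel x)) = ε *
      (rd E (rd E f₁ (e.toModel (bs k))) (e.toModel x) g * (rd E f₂ (e.toModel (bs j)) g *
        B.pairing (skewOp eD (ψ g) (l k)) (l j))
      + rd E f₁ (e.toModel (bs k)) g * (rd E (rd E f₂ (e.toModel (bs j))) (e.toModel x) g *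
        B.pairing (skewOp eD (ψ g) (l k)) (l j))
      - (rd E f₁ (e.toModel (bs k)) g * (rd E f₂ (e.toModel (bs j)) g * B.pairing
        (projAd eD (ψ g) ⁅ι x, l k⁆) (l j)) +
       rd E f₁ (e.toModel (bs k)) g * (rd E f₂ (e.toModel (bs j)) g * B.pairing
         (projAd eD (ψ g) (l k)) ⁅ι x, l j⁆))) := by
    intro k j
    rw [mder_mul (d₁ k) (mdifferentiableAt_fun_mul (d₂ j) (d₄ _ _)), mder_mul (d₂ j) (d₄ _ _),
      mder_mul mdifferentiableAt_const (d₃ _ _), mder_const, e₃, e₄, e₅]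
    simp only [_root_.zero_apply]
    ring
  simp only [h6, grad, gradDeriv, lie_sum, lie_smul, map_sum, map_smul, LinearMap.sum_apply,
    LinearMap.smul_apply, smul_eq_mul, ← Finset.mul_sum, Finset.sum_add_distrib,
    Finset.sum_sub_distrib]
  -- Expanding the pairing bilinearly yields the two sums in the opposite nesting order.
  have swap : ∀ (c d : κ → ℝ) (P : κ → κ → ℝ),
      ∑ k, c k * ∑ j, d j * P k j = ∑ j, d j * ∑ k, c k * P k j := fun c d P => by
    simp only [Finset.mul_sum]
    rw [Finset.sum_comm]
    exact Finset.sum_congr rfl fun j _ => Finset.sum_congr rfl fun k _ => mul_left_comm _ _ _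
  exact congrArg (ε * ·) (congrArg₂ (· - ·) (congrArg₂ (· + ·) (swap _ _ _) (swap _ _ _))
    (congrArg₂ (· + ·) (swap _ _ _) (swap _ _ _)))

/-- The Hamiltonian derivative of fᵢ is the derivative along xᵢ^r, up to ε. The second derivatives
of each function occur twice, with opposite signs and exchanged directions, and so reduce to its
gradient paired with a bracket; the rest is `IsLagrangianProj.jacobi`. -/
theorem jacobi (h : IsInduced eD e ι ψ ε π)
    (hl : ∀ k x, B.pairing (l k) (ι x) = bs.coord k x) {f₁ f₂ f₃ : G → ℝ} {g : G}
    (h₁ : SmoothAt E f₁ g) (h₂ : SmoothAt E f₂ g) (h₃ : SmoothAt E f₃ g) :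
    poissonBracket π f₁ (poissonBracket π f₂ f₃) g + poissonBracket π f₂ (poissonBracket π f₃ f₁) g +
      poissonBracket π f₃ (poissonBracket π f₁ f₂) g = 0 := by
  -- Only because the skew operator takes values in the image of ι are these directions tangent to
  -- the group itself.
  obtain ⟨x₁, hx₁⟩ := h.skewOp_mem g (grad e bs l f₁ g)
  obtain ⟨x₂, hx₂⟩ := h.skewOp_mem g (grad e bs l f₂ g)
  obtain ⟨x₃, hx₃⟩ := h.skewOp_mem g (grad e bs l f₃ g)
  have comm : ∀ f : G → ℝ, SmoothAt E f g → ∀ x y : 𝔞,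
      B.pairing (gradDeriv e bs l f x g) (ι y) - B.pairing (gradDeriv e bs l f y g) (ι x) =
        B.pairing (grad e bs l f g) ⁅ι x, ι y⁆ := fun f hf x y => by
    rw [pairing_gradDeriv e hl hf, pairing_gradDeriv e hl hf, ← h.map_lie, pairing_grad e hl,
      e.toModel_lie, rd_rbr hf]
  have key : ∀ (f f' f'' : G → ℝ) (x x' x'' : 𝔞), SmoothAt E f' g → SmoothAt E f'' g →
      ι x = skewOp eD (ψ g) (grad e bs l f g) → ι x' = skewOp eD (ψ g) (grad e bs l f' g) →
      ι x'' = skewOp eD (ψ g) (grad e bs l f'' g) →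
      poissonBracket π f (poissonBracket π f' f'') g =
        B.pairing (gradDeriv e bs l f'' x g) (ι x') - B.pairing (gradDeriv e bs l f' x g) (ι x'') -
       (B.pairing (projAd eD (ψ g) ⁅ι x, grad e bs l f' g⁆) (grad e bs l f'' g) +
        B.pairing (projAd eD (ψ g) (grad e bs l f' g)) ⁅ι x, grad e bs l f'' g⁆) := by
    intro f f' f'' x x' x'' hf' hf'' hx hx' hx''
    -- The outer bracket becomes a derivative along x; skewness moves the operator onto the
    -- undifferentiated gradients, and the signs of the inner and outer brackets cancel as ε² = 1.
    rw [h.poissonBracket_eq hl, ← hx, pairing_symm, pairing_grad e hl, h.rd_poissonBracket hl hf'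
      hf'',
      ← hx', pairing_skewOp, ← hx'', pairing_symm B (ι x'), ← mul_assoc, h.sq]
    ring
  rw [key f₁ f₂ f₃ x₁ x₂ x₃ h₂ h₃ hx₁ hx₂ hx₃, key f₂ f₃ f₁ x₂ x₃ x₁ h₃ h₁ hx₂ hx₃ hx₁,
    key f₃ f₁ f₂ x₃ x₁ x₂ h₁ h₂ hx₃ hx₁ hx₂]
  have c₁ := comm f₁ h₁ x₂ x₃
  have c₂ := comm f₂ h₂ x₃ x₁
  have c₃ := comm f₃ h₃ x₁ x₂
  have j := IsLagrangianProj.jacobi (pairing_symm B) B.pairing_lie (isLagrangianProj_projG B)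
    (isLagrangianProj_projAd eD (ψ g)) (grad e bs l f₁ g) (grad e bs l f₂ g) (grad e bs l f₃ g)
  simp only [← skewOp_apply, ← hx₁, ← hx₂, ← hx₃] at j
  linarith

end Gradient

theorem isPoissonLieGroup (h : IsInduced eD e ι ψ ε π) : IsPoissonLieGroup π := by
  have : FiniteDimensional ℝ 𝔞 := e.toModel.symm.finiteDimensional
  let bs := Module.finBasis ℝ 𝔞
  choose l hl using fun k => h.exists_lift (bs.coord k)
  exact ⟨⟨h.alt, fun x f₁ f₂ => h.contMDiffAt_poissonBracket hl,
    fun x f₁ f₂ f₃ => h.jacobi hl⟩, h.isMultiplicative⟩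

end IsInduced
end Induced

/-! ### The three bivector fields as induced fields, and their linearizations. -/

section Main
variable {𝔤 : Type*} [LieRing 𝔤] [LieAlgebra ℝ 𝔤] [FiniteDimensional ℝ 𝔤] {B : LieBialgebra 𝔤}
  {ED : Type*} [NormedAddCommGroup ED] [NormedSpace ℝ ED] [FiniteDimensional ℝ ED]
  {D : Type*} [TopologicalSpace D] [ChartedSpace ED D] [Group D] [LieGroup 𝓘(ℝ, ED) ∞ D]
  {E : Type*} [NormedAddCommGroup E] [NormedSpace ℝ E] [FiniteDimensional ℝ E]
  {G : Type*} [TopologicalSpace G] [ChartedSpace E G] [Group G] [LieGroup 𝓘(ℝ, E) ∞ G]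
  (eD : QuadraticIdent B ED D)

/-- Contraction of R gives ½(⟨pa, b⟩ - ⟨pb, a⟩), and ⟨pb, a⟩ = ⟨a, b⟩ - ⟨pa, b⟩ since 𝔤 and 𝔤* are
isotropic. -/
theorem rmatrix_pairing {κ : Type*} [Fintype κ] (u : Module.Basis κ ℝ 𝔤) (a b : B.Double) :
    rmatrix B u (B.pairing a) (B.pairing b) =
      B.pairing (projG B a) b - (1 / 2 : ℝ) * B.pairing a b := by
  have h1 : ∀ a b : B.Double, ∑ i, u.coord i (B.prg a) * B.toDual (B.prgs b) (u i) =
      B.pairing (projG B a) b := fun a b => by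
    rw [projG, LinearMap.comp_apply, pairing_symm, pairing_inl_right]
    conv_rhs => rw [← u.sum_repr (B.prg a)]
    simp only [map_sum, map_smul, smul_eq_mul, Module.Basis.coord_apply]
  have h2 : rmatrix B u (B.pairing a) (B.pairing b) = (1 / 2 : ℝ) *
      (∑ i, u.coord i (B.prg a) * B.toDual (B.prgs b) (u i) -
        ∑ i, u.coord i (B.prg b) * B.toDual (B.prgs a) (u i)) := by
    rw [← Finset.sum_sub_distrib]
    simp only [rmatrix, wedge, LinearMap.smul_apply, LinearMap.sum_apply, LinearMap.sub_apply,
      LinearMap.BilinForm.linMulLin_apply, Module.Dual.eval_apply, pairing_inr_right,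
      pairing_inl_right, LinearEquiv.apply_symm_apply, smul_eq_mul]
    congr 1
    exact Finset.sum_congr rfl fun i _ => by ring
  rw [h2, h1, h1, (isLagrangianProj_projG B).adj b a, pairing_symm B b a,
    pairing_symm B b (projG B a)]
  ring

theorem exists_pairing_eq (ξ : Module.Dual ℝ B.Double) : ∃ a, ∀ x, B.pairing a x = ξ x := by
  -- The pairing exchanges the summands: the restriction of ξ to 𝔤* supplies the component in 𝔤, and
  -- conversely.
  refine ⟨B.inl (B.ofBidual (ξ ∘ₗ B.inr)) + B.inr (B.toDual.symm (ξ ∘ₗ B.inl)), fun x => ?_⟩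
  have hx : x = B.inl (B.prg x) + B.inr (B.prgs x) := (projG_add_inr B x).symm
  conv_rhs => rw [hx]
  rw [B.pairing_apply]
  simp [prg_inl, prg_inr, prgs_inl, prgs_inr, add_comm]

theorem isInduced_piD {κ : Type*} [Fintype κ] (u : Module.Basis κ ℝ 𝔤) :
    IsInduced eD eD.toLieAlgebraIdent LinearMap.id (MonoidHom.id D) 1 (piD eD u) where
  integration := .id _
  map_lie _ _ := rfl
  exists_lift := exists_pairing_eq
  skewOp_mem _ a := ⟨_, rfl⟩
  sq := one_mul 1
  apply d α β a b ha hb := by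
    have hr : ∀ (α : Module.Dual ℝ (TangentSpace 𝓘(ℝ, ED) d)) (a : B.Double),
        Represents eD.toLieAlgebraIdent LinearMap.id d α a →
        (rightTriv ED d ∘ₗ eD.equiv.toLinearMap).dualMap α = B.pairing a := fun α a ha =>
      LinearMap.ext fun x => (ha x).symm
    -- The left invariant field of x agrees at d with the right invariant field of Ad_d x; by
    -- invariance this replaces a by Ad_{d⁻¹} a.
    have hl : ∀ (α : Module.Dual ℝ (TangentSpace 𝓘(ℝ, ED) d)) (a : B.Double),
        Represents eD.toLieAlgebraIdent LinearMap.id d α a →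
        (leftTriv ED d ∘ₗ eD.equiv.toLinearMap).dualMap α = B.pairing (eD.Ad d⁻¹ a) := fun α a ha =>
      LinearMap.ext fun x => by
        rw [← pairing_Ad_right]
        exact (congrArg α (eD.leftTriv_eq_rightTriv d x)).trans (ha _).symm
    simp only [piD, LinearMap.sub_apply, LinearMap.compl₁₂_apply, hr α a ha, hr β b hb, hl α a ha,
      hl β b hb, rmatrix_pairing]
    rw [MonoidHom.id_apply, skewOp_apply, projAd_apply, map_sub, LinearMap.sub_apply,
      eD.pairing_Ad d⁻¹ a b, pairing_Ad_left eD d (projG B (eD.Ad d⁻¹ a)) b]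
    ring

theorem IsInduced.neg {𝔞 : Type*} [LieRing 𝔞] [LieAlgebra ℝ 𝔞] {eD : QuadraticIdent B ED D}
    {e : LieAlgebraIdent E G 𝔞} {ι : 𝔞 →ₗ[ℝ] B.Double} {ψ : G →* D} {ε : ℝ} {π : TensorField E G}
    (h : IsInduced eD e ι ψ ε π) : IsInduced eD e ι ψ (-ε) (-π) where
  integration := h.integration
  map_lie := h.map_lie
  exists_lift := h.exists_lift
  skewOp_mem := h.skewOp_mem
  sq := by rw [neg_mul_neg, h.sq]
  apply g α β a b ha hb := by
    rw [Pi.neg_apply, LinearMap.neg_apply, LinearMap.neg_apply, h.apply g α β a b ha hb, neg_mul]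

theorem projAd_eq_inl {eG : LieAlgebraIdent E G 𝔤} {φ : G →* D}
    (hφ : IsIntegration eG eD.toLieAlgebraIdent B.inl φ) (g : G) (a : B.Double) :
    projAd eD (φ g) a = B.inl (eG.Ad g (B.prg (eD.Ad (φ g)⁻¹ a))) := (hφ.map_Ad g _).symm

theorem sub_projAd_eq_inr {eS : LieAlgebraIdent E G B.DualAlg} {φ : G →* D}
    (hφ : IsIntegration eS eD.toLieAlgebraIdent B.inr φ) (g : G) (a : B.Double) :
    a - projAd eD (φ g) a = B.inr (eS.Ad g (B.prgs (eD.Ad (φ g)⁻¹ a))) := by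
  rw [hφ.map_Ad, ← sub_projG, map_sub, eD.Ad_Ad_inv]; rfl

/-- If α = ξ^l is represented by a, then Ad_{φ(g)} ξ = (1 - q) a, so π_G(α, β) = ⟨p(1-q)a,
(1-p)(1-q)b⟩. Since Ad_{φ(g)} preserves 𝔤, the image of q lies in 𝔤 and pq = q; so the first entry
is (p - q)a ∈ 𝔤, and the parts of the second entry other than b are in 𝔤, hence orthogonal to it. -/
theorem isInduced_piG (eG : LieAlgebraIdent E G 𝔤) (φ : G →* D)
    (hφ : IsIntegration eG eD.toLieAlgebraIdent B.inl φ) :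
    IsInduced eD eG B.inl φ 1 (piG eD eG φ) where
  integration := hφ
  map_lie := inl_lie B
  exists_lift ξ := ⟨B.inr (B.toDual.symm ξ), fun x => by
    rw [pairing_inl_right, prgs_inr, LinearEquiv.apply_symm_apply]⟩
  skewOp_mem g a := ⟨B.prg a - eG.Ad g (B.prg (eD.Ad (φ g)⁻¹ a)), by
    rw [map_sub, ← projAd_eq_inl eD hφ]; rfl⟩
  sq := one_mul 1
  apply g α β a b ha hb := by
    have hl : ∀ (α : Module.Dual ℝ (TangentSpace 𝓘(ℝ, E) g)) (a : B.Double),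
        Represents eG B.inl g α a →
        eD.Ad (φ g) (B.inr (leftCoord eG g α)) = a - projAd eD (φ g) a := fun α a ha => by
      have h : leftCoord eG g α = B.prgs (eD.Ad (φ g)⁻¹ a) := by
        refine B.dual_ext fun x => ?_
        rw [← pairing_inl_right, ← pairing_Ad_right, ← hφ.map_Ad, ha]
        exact congrArg α (eG.leftTriv_eq_rightTriv g x)
      rw [h, ← sub_projG, map_sub, eD.Ad_Ad_inv]; rfl
    have h1 : ∀ c : B.Double, B.inl (B.prg c) = projG B c := fun _ => rfl
    simp only [piG, LinearMap.compl₁₂_apply, LinearMap.comp_apply, hl α a ha, hl β b hb, h1]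
    rw [← sub_projG, one_mul]
    have h2 : projG B (a - projAd eD (φ g) a) = skewOp eD (φ g) a := by
      rw [map_sub, projAd_eq_inl eD hφ, skewOp_apply, projAd_eq_inl eD hφ]; rfl
    have h3 : ∀ x : 𝔤, B.pairing (skewOp eD (φ g) a) (B.inl x) = 0 := fun x => by
      rw [skewOp_apply, projAd_eq_inl eD hφ, ← h1, ← map_sub, pairing_inl_inl]
    rw [h2, map_sub, map_sub, projAd_eq_inl eD hφ, h3, ← h1, h3, sub_zero, sub_zero]

/-- The covector u^r represented by a has u = pa, so π_G*(α, β) = ⟨q p a, p b⟩. As Ad_{φ(v)}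
preserves 𝔤*, q kills 𝔤* and qp = q. Finally ⟨qa, b⟩ - ⟨qa, pb⟩ = ⟨a, (1-p)b⟩ = ⟨pa, b⟩, which
yields -⟨(p - q)a, b⟩ and explains the sign ε = -1. -/
theorem isInduced_piGs (eS : LieAlgebraIdent E G B.DualAlg) (φ : G →* D)
    (hφ : IsIntegration eS eD.toLieAlgebraIdent B.inr φ) :
    IsInduced eD eS B.inr φ (-1) (piGs eD eS φ) where
  integration := hφ
  map_lie := inr_lie B
  exists_lift ξ := ⟨B.inl (B.ofBidual ξ), fun x => by
    rw [pairing_inr_right, prg_inl, B.toDual_ofBidual]⟩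
  skewOp_mem g a := ⟨eS.Ad g (B.prgs (eD.Ad (φ g)⁻¹ a)) - B.prgs a, by
    rw [map_sub, ← sub_projAd_eq_inr eD hφ, ← sub_projG, skewOp_apply]; abel⟩
  sq := by norm_num
  apply g α β a b ha hb := by
    have hr : ∀ (α : Module.Dual ℝ (TangentSpace 𝓘(ℝ, E) g)) (a : B.Double),
        Represents eS B.inr g α a → B.inl (rightCoord eS g α) = projG B a := fun α a ha => by
      have h : rightCoord eS g α = B.prg a := B.ofBidual_eq _ _ fun ξ => by
        rw [← pairing_inr_right, ha]; rfl
      rw [h]; rfl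
    have h1 : ∀ c : B.Double, B.inl (B.prg c) = projG B c := fun _ => rfl
    simp only [piGs, LinearMap.compl₁₂_apply, LinearMap.comp_apply, hr α a ha, hr β b hb, h1]
    have h2 : ∀ c d : B.Double, B.pairing (projG B c) (projG B d) = 0 := fun c d =>
      pairing_inl_inl B _ _
    have h3 : ∀ y : B.DualAlg, projAd eD (φ g) (B.inr y) = 0 := fun y => by
      have hy : eD.Ad (φ g)⁻¹ (B.inr y) = B.inr (eS.Ad g⁻¹ y) := by
        rw [hφ.map_Ad, map_inv]
      rw [projAd_apply, hy]
      exact map_zero (eD.Ad (φ g))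
    have h4 : ∀ c, projAd eD (φ g) (projG B c) = projAd eD (φ g) c := fun c => by
      have h := congrArg (projAd eD (φ g)) (projG_add_inr B c)
      rwa [map_add, h3, add_zero] at h
    rw [← sub_projG, map_sub, h2, sub_zero, ← pairing_Ad_left, ← projAd_apply, h4]
    have h5 : B.pairing (projAd eD (φ g) a) b = B.pairing (projAd eD (φ g) a) (projG B b) +
        B.pairing a (B.inr (B.prgs b)) := by
      conv_lhs => rw [← projG_add_inr B b, map_add]
      rw [(isLagrangianProj_projAd eD (φ g)).adj a (B.inr (B.prgs b)), h3, map_zero, sub_zero]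
    have h6 : B.pairing a (B.inr (B.prgs b)) = B.pairing (projG B a) b := by
      rw [(isLagrangianProj_projG B).adj, ← sub_projG, map_sub]
    rw [skewOp_apply, map_sub, LinearMap.sub_apply, h5, h6]
    ring

/-- With representatives ξ, η ∈ 𝔤* the term containing pξ vanishes. The other is -η(pr_𝔤 [x, ξ]) =
η(ad*_ξ x) = [η, ξ](x), which is the cobracket by skewness. -/
theorem hasLieBialgebra_piG (eG : LieAlgebraIdent E G 𝔤) (φ : G →* D)
    (hφ : IsIntegration eG eD.toLieAlgebraIdent B.inl φ) :
    HasLieBialgebra eG (piG eD eG φ) B := by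
  refine (isInduced_piG eD eG φ hφ).hasLieBialgebra B fun x ξ η =>
    ⟨B.inr (B.toDual.symm ξ), B.inr (B.toDual.symm η), fun x => ?_, fun x => ?_, ?_⟩
  · rw [pairing_inl_right, prgs_inr, LinearEquiv.apply_symm_apply]
  · rw [pairing_inl_right, prgs_inr, LinearEquiv.apply_symm_apply]
  · have h1 : projG B (B.inr (B.toDual.symm ξ)) = 0 := map_zero B.inl
    have h2 : B.prg ⁅B.inl x, B.inr (B.toDual.symm ξ)⁆ = - B.coadDual (B.toDual.symm ξ) x := by
      rw [B.prg_lie, prg_inl, prgs_inl, prg_inr, prgs_inr, lie_zero, coadDual_zero_right]; simp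
    rw [h1, map_zero, LinearMap.zero_apply, add_zero, pairing_inr_right]
    change _ = -1 * B.toDual (B.toDual.symm η) (B.prg ⁅B.inl x, B.inr (B.toDual.symm ξ)⁆)
    rw [h2, map_neg, B.coadDual_apply, B.toDual_lie, B.cobracket_swap]
    simp

/-- With representatives u, w ∈ 𝔤 the first term pairs two elements of 𝔤 and vanishes. The other,
⟨u, [ξ, w]⟩ = -(ad*_w ξ)(u) = -ξ([u, w]), is the dual cobracket. -/
theorem hasLieBialgebra_piGs (eS : LieAlgebraIdent E G B.DualAlg) (φ : G →* D)
    (hφ : IsIntegration eS eD.toLieAlgebraIdent B.inr φ) :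
    HasLieBialgebra eS (piGs eD eS φ) B.dual := by
  refine (isInduced_piGs eD eS φ hφ).hasLieBialgebra B.dual fun ξ α β =>
    ⟨B.inl (B.ofBidual α), B.inl (B.ofBidual β), fun x => ?_, fun x => ?_, ?_⟩
  · rw [pairing_inr_right, prg_inl, B.toDual_ofBidual]
  · rw [pairing_inr_right, prg_inl, B.toDual_ofBidual]
  · have h1 : ∀ c : B.Double, ∀ x : 𝔤, B.pairing (projG B c) (B.inl x) = 0 := fun c x =>
      pairing_inl_inl B _ _
    have h2 : projG B (B.inl (B.ofBidual α)) = B.inl (B.ofBidual α) := rfl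
    rw [h1, h2, zero_add, pairing_symm, pairing_inl_right, B.prgs_lie, prgs_inr, prgs_inl, prg_inl,
      prg_inr, lie_zero, coad_zero_left]
    simp only [add_zero, zero_sub, map_neg, LinearMap.neg_apply, B.coad_apply]
    change B.dualCobracket ξ α β = _
    rw [B.dualCobracket_apply]
    ring
end Main

end PoissonLie

end

theorem mainTheorem9
    {𝔤 : Type*} [LieRing 𝔤] [LieAlgebra ℝ 𝔤] [FiniteDimensional ℝ 𝔤] (B : LieBialgebra 𝔤)
    {ED : Type*} [NormedAddCommGroup ED] [NormedSpace ℝ ED] [FiniteDimensional ℝ ED]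
    {D : Type*} [TopologicalSpace D] [ChartedSpace ED D] [Group D] [LieGroup 𝓘(ℝ, ED) ∞ D]
    {EG : Type*} [NormedAddCommGroup EG] [NormedSpace ℝ EG] [FiniteDimensional ℝ EG]
    {G : Type*} [TopologicalSpace G] [ChartedSpace EG G] [Group G] [LieGroup 𝓘(ℝ, EG) ∞ G]
    {ES : Type*} [NormedAddCommGroup ES] [NormedSpace ℝ ES] [FiniteDimensional ℝ ES]
    {Gs : Type*} [TopologicalSpace Gs] [ChartedSpace ES Gs] [Group Gs] [LieGroup 𝓘(ℝ, ES) ∞ Gs]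
    (eD : PoissonLie.QuadraticIdent B ED D)
    (eG : PoissonLie.LieAlgebraIdent EG G 𝔤)
    (eS : PoissonLie.LieAlgebraIdent ES Gs B.DualAlg)
    (φG : G →* D) (hφG : PoissonLie.IsIntegration eG eD.toLieAlgebraIdent B.inl φG)
    (φS : Gs →* D) (hφS : PoissonLie.IsIntegration eS eD.toLieAlgebraIdent B.inr φS)
    {ι : Type*} [Fintype ι] (u : Module.Basis ι ℝ 𝔤) :
    PoissonLie.IsPoissonLieGroup (PoissonLie.piG eD eG φG) ∧
    PoissonLie.IsPoissonLieGroup (PoissonLie.piGs eD eS φS) ∧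
    PoissonLie.IsPoissonLieGroupHom (PoissonLie.piG eD eG φG) (PoissonLie.piD eD u) φG ∧
    PoissonLie.IsPoissonLieGroupHom (PoissonLie.piGs eD eS φS) (-PoissonLie.piD eD u) φS ∧
    PoissonLie.HasLieBialgebra eG (PoissonLie.piG eD eG φG) B ∧
    PoissonLie.IsDualPoissonLieGroup B eG (PoissonLie.piG eD eG φG) eS
      (PoissonLie.piGs eD eS φS) := by
  have hD := PoissonLie.isInduced_piD eD u
  have hG := PoissonLie.isInduced_piG eD eG φG hφG
  have hS := PoissonLie.isInduced_piGs eD eS φS hφS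
  exact ⟨hG.isPoissonLieGroup, hS.isPoissonLieGroup,
    ⟨hG.isPoissonLieGroup, hD.isPoissonLieGroup, hφG.smooth, hG.map_apply hD⟩,
    ⟨hS.isPoissonLieGroup, hD.neg.isPoissonLieGroup, hφS.smooth, hS.map_apply hD.neg⟩,
    PoissonLie.hasLieBialgebra_piG eD eG φG hφG,
    ⟨hG.isPoissonLieGroup, PoissonLie.hasLieBialgebra_piG eD eG φG hφG, hS.isPoissonLieGroup,
      PoissonLie.hasLieBialgebra_piGs eD eS φS hφS⟩⟩
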